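/- Let $V_{\mathrm{odd}},V_{\mathrm{even}}\subset\mathbb R^d$ be finite sets with $V_{\mathrm{even}}=-V_{\mathrm{odd}}$, $V_{\mathrm{odd}}\cap V_{\mathrm{even}}=\emptyset$ and $m=\#V_{\mathrm{odd}}\ge 2$. Put $V=V_{\mathrm{odd}}\cup V_{\mathrm{even}}$, and write $V_k=V_{\mathrm{odd}}$ for odd $k$ and $V_k=V_{\mathrm{even}}$ for even $k$. Fix $p,q\in[0,1]$ and set $$\alpha=\frac{mp-1}{m-1},\qquad \beta=\frac{mq-1}{m-1},\qquad \delta=\frac{\alpha-\beta}{2}.$$ An elephant random walk (with these data) is defined as follows on a probability space. $X_1$ is uniformly distributed on $V_{\mathrm{odd}}$; for $n\ge 1$, $\mathcal U_n$ is uniformly distributed on $\{1,\dots,n\}$; for $k\ge 2$ and $v\in V$, $G_k(v)$ is a $V_k$-valued random variable such that, for $w\in V_k$, $$P(G_k(v)=w)=\begin{cases}p,& w=v,\\ \frac{1-p}{m-1},& w\ne v,\end{cases}\quad\text{if } v\in V_k,\qquad P(G_k(v)=w)=\begin{cases}q,& w=-v,\\ \frac{1-q}{m-1},& w\neq -v,\end{cases}\quad\text{if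 } v\in V\setminus V_k.$$ The $\sigma$-fields $\sigma(X_1)$, $\sigma(\mathcal U_1,\{G_2(v)\}_{v\in V})$, $\sigma(\mathcal U_2,\{G_3(v)\}_{v\in V}),\dots$ are independent, and, for all $n\ge1$ and $v\in V$, $\mathcal U_n$ is independent of $G_{n+1}(v)$. Set $X_{n+1}=G_{n+1}(X_{\mathcal U_n})$ for $n\ge1$, $S_0=0$, and $S_{n+1}=S_n+X_{n+1}$ for $n\ge0$. Theorem. Assume $1/2<\delta<1$. There is a constant $C_{\alpha,\beta}>0$, depending only on $\alpha$, $\beta$ and the step sets $V_{\mathrm{odd}},V_{\mathrm{even}}$, such that for every such elephant random walk $S_n$ is square-integrable for all $n$, $$E\big[|S_n-E[S_n]|^2\big]\sim C_{\alpha,\beta}\,n^{2\delta}\qquad(n\to\infty),$$ and there is a square-integrable random vector $L\in\mathbb R^d$ such that $$\lim_{n\to\infty}\frac{S_n}{n^\delta}=L\quad\text{almost surely and in }L^2,\qquad E[L]=0,\qquad E[|L|^2]=C_{\alpha,\beta}.$$ In particular, $L$ is not almost surely constant. -/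

import Mathlib

open MeasureTheory ProbabilityTheory Filter Topology Asymptotics

noncomputable section

namespace ERW

/-- The two finite sets of admissible steps in `ℝ^d`: `odd` is used at odd times, `even` at even
times. They are negatives of each other, disjoint, and have at least two elements. -/
structure StepSets (d : ℕ) where
  odd : Finset (EuclideanSpace ℝ (Fin d))
  even : Finset (EuclideanSpace ℝ (Fin d))
  mem_odd_iff : ∀ v, v ∈ odd ↔ -v ∈ even
  disjoint : Disjoint odd even
  two_le_card : 2 ≤ odd.card

namespace StepSets

variable {d : ℕ} (V : StepSets d)

/-- The common cardinality of the two step sets. -/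
def m : ℕ := V.odd.card

/-- The set of all steps. -/
def all : Set (EuclideanSpace ℝ (Fin d)) := {v | v ∈ V.odd ∨ v ∈ V.even}

/-- The steps that are admissible at time `k`. -/
def at_ (k : ℕ) : Finset (EuclideanSpace ℝ (Fin d)) := if Odd k then V.odd else V.even

/-- `α = (m p - 1) / (m - 1)`. -/
def alpha (p : ℝ) : ℝ := ((V.m : ℝ) * p - 1) / ((V.m : ℝ) - 1)

/-- `β = (m q - 1) / (m - 1)`. -/
def beta (q : ℝ) : ℝ := ((V.m : ℝ) * q - 1) / ((V.m : ℝ) - 1)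

/-- `δ = (α - β) / 2`. -/
def delta (p q : ℝ) : ℝ := (V.alpha p - V.beta q) / 2

end StepSets

/-- The σ-fields `σ(X₁)`, `σ(U₁, {G₂(v)}_v)`, `σ(U₂, {G₃(v)}_v)`, … -/
def innovation {d : ℕ} (V : StepSets d) {Ω : Type*}
    (X : ℕ → Ω → EuclideanSpace ℝ (Fin d)) (U : ℕ → Ω → ℕ)
    (G : ℕ → EuclideanSpace ℝ (Fin d) → Ω → EuclideanSpace ℝ (Fin d)) :
    ℕ → MeasurableSpace Ω
  | 0 => MeasurableSpace.comap (X 1) inferInstance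
  | n + 1 => MeasurableSpace.comap (U (n + 1)) inferInstance ⊔
      ⨆ v ∈ V.all, MeasurableSpace.comap (G (n + 2) v) inferInstance

/-- An elephant random walk on a probability space, with step sets `V` and memory parameters `p`
and `q`. Only the values `X n` and `U n` for `n ≥ 1`, and `G k v` for `k ≥ 2` and `v ∈ V.all`, are
meaningful. -/
structure Walk {d : ℕ} (V : StepSets d) (p q : ℝ) {Ω : Type*} [MeasurableSpace Ω]
    (P : Measure Ω) where
  /-- the increments -/
  X : ℕ → Ω → EuclideanSpace ℝ (Fin d)
  /-- the remembered times -/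
  U : ℕ → Ω → ℕ
  /-- the reaction, at time `k`, to the remembered step `v` -/
  G : ℕ → EuclideanSpace ℝ (Fin d) → Ω → EuclideanSpace ℝ (Fin d)
  measurable_first : Measurable (X 1)
  first_mem : ∀ ω, X 1 ω ∈ V.odd
  /-- the first step is uniform on `V.odd` -/
  law_first : ∀ w ∈ V.odd, P.real {ω | X 1 ω = w} = 1 / (V.m : ℝ)
  measurable_U : ∀ n, 1 ≤ n → Measurable (U n)
  U_mem : ∀ n, 1 ≤ n → ∀ ω, U n ω ∈ Finset.Icc 1 n
  /-- `U n` is uniform on `{1, …, n}` -/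
  law_U : ∀ n, 1 ≤ n → ∀ k ∈ Finset.Icc 1 n, P.real {ω | U n ω = k} = 1 / (n : ℝ)
  measurable_G : ∀ k, 2 ≤ k → ∀ v ∈ V.all, Measurable (G k v)
  G_mem : ∀ k, 2 ≤ k → ∀ v ∈ V.all, ∀ ω, G k v ω ∈ V.at_ k
  /-- reaction to a step that is itself admissible at time `k` -/
  law_G_same : ∀ k, 2 ≤ k → ∀ v ∈ V.at_ k, ∀ w ∈ V.at_ k,
    (w = v → P.real {ω | G k v ω = w} = p) ∧
    (w ≠ v → P.real {ω | G k v ω = w} = (1 - p) / ((V.m : ℝ) - 1))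
  /-- reaction to a step of the opposite parity, that is, one in `V.at_ (k + 1)` -/
  law_G_opposite : ∀ k, 2 ≤ k → ∀ v ∈ V.at_ (k + 1), ∀ w ∈ V.at_ k,
    (w = -v → P.real {ω | G k v ω = w} = q) ∧
    (w ≠ -v → P.real {ω | G k v ω = w} = (1 - q) / ((V.m : ℝ) - 1))
  /-- `X₁`, `(U₁, G₂)`, `(U₂, G₃)`, … are independent -/
  indep : iIndep (innovation V X U G) P
  /-- the remembered time is independent of the reaction to each given step -/
  indep_U_G : ∀ n, 1 ≤ n → ∀ v ∈ V.all, IndepFun (U n) (G (n + 1) v) P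
  /-- `X_{n+1} = G_{n+1}(X_{U_n})` -/
  X_succ : ∀ n, 1 ≤ n → ∀ ω, X (n + 1) ω = G (n + 1) (X (U n ω) ω) ω

/-- The position `S₀ = 0`, `S_{n+1} = S_n + X_{n+1}`. -/
def Walk.S {d : ℕ} {V : StepSets d} {p q : ℝ} {Ω : Type*} [MeasurableSpace Ω] {P : Measure Ω}
    (W : Walk V p q P) : ℕ → Ω → EuclideanSpace ℝ (Fin d)
  | 0 => fun _ => 0
  | n + 1 => fun ω => W.S n ω + W.X (n + 1) ω

end ERW

end

namespace ERW

/-! The argument works coordinate by coordinate with centred steps `x`, their partial sums `A` and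
alternating sums `B`. A remembered step of the same parity enters the conditional mean of the next
step with slope `α = δ + γ`, one of the opposite parity with slope `-β = δ - γ`, where `γ = (α + β)
/ 2`. The conditional mean of `x n` is therefore `(δ A n - γ (-1)^n B n) / n`.

Convergence: the deviations from these means, divided by `(k + 1)^δ`, sum to a martingale that is
bounded in `L²` because `2δ > 1`. The difference between `A n / n^δ` and this martingale converges
on every path, at a rate fixed by the bound on the steps (`exists_rate_partialSum_sub_noiseSum`):
the `δ`-part of the drift is absorbed by the normalisation, and the `γ`-part oscillates in sign, so
it cancels in pairs. The means of the steps alternate in sign, hence `E[S n]` is bounded and does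
not affect the limit.

The constant: the second moments `a`, `b`, `c` of `A`, of `B` and of the product `A B`, summed over
coordinates, obey a closed recursion starting at zero (`IsMomentRecursion`). They are the same for
all walks with the same data, and so is the limit of `a n / n^(2δ)`, which equals `E[|L|²]`.

Positivity (`IsMomentRecursion.limit_pos`): the corrected moment `z n = a n - γ (-1)^n c n / n`
satisfies `z (n+1) = (1 + 1/n)^(2δ) z n + σ² + o(1)`, because all three moments are `o(n²)`; this is
where `δ < 1` enters. Hence `z n / n^(2δ)` is eventually nondecreasing and positive, and it has the
same limit as `a n / n^(2δ)`. -/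

/-! ### Elementary estimates for real powers -/

/-- One side is Bernoulli's inequality for a concave power. The other is the same inequality applied
to `(1 + t)⁻¹ = 1 - t / (1 + t)`, together with `(1 + δ t - t²) (1 - δ t / (1 + t)) ≤ 1`. -/
theorem abs_one_add_mul_sub_rpow_le {δ t : ℝ} (h0 : 0 ≤ δ) (h1 : δ ≤ 1) (ht : 0 < t) :
    |1 + δ * t - (1 + t) ^ δ| ≤ t ^ 2 := by
  have hup := rpow_one_add_le_one_add_mul_self (s := t) (by linarith) h0 h1
  have hs : 0 < 1 + t := by linarith
  have hinv := rpow_one_add_le_one_add_mul_self (s := -(t / (1 + t)))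
    (by rw [neg_le_neg_iff, div_le_one hs]; linarith) h0 h1
  have he : 1 + -(t / (1 + t)) = (1 + t)⁻¹ := by field_simp; ring
  rw [he, Real.inv_rpow hs.le] at hinv
  have hpos : 0 < (1 + t) ^ δ := Real.rpow_pos_of_pos hs δ
  have hlow : 1 + δ * t - t ^ 2 ≤ (1 + t) ^ δ := by
    by_contra! hlt
    have h2 : (1 + t) ^ δ * (1 + δ * -(t / (1 + t))) < 1 := by
      have hc : 0 < 1 + δ * -(t / (1 + t)) := by
        have : t / (1 + t) < 1 := by rw [div_lt_one hs]; linarith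
        have : 0 < t / (1 + t) := by positivity
        nlinarith
      calc (1 + t) ^ δ * (1 + δ * -(t / (1 + t)))
          < (1 + δ * t - t ^ 2) * (1 + δ * -(t / (1 + t))) := by gcongr
        _ ≤ 1 := by
          have : (1 + δ * t - t ^ 2) * (1 + δ * -(t / (1 + t))) - 1
              = -(t ^ 2 * ((1 - δ) + δ ^ 2 + t * (1 - δ))) / (1 + t) := by
            field_simp; ring
          have h3 : -(t ^ 2 * ((1 - δ) + δ ^ 2 + t * (1 - δ))) / (1 + t) ≤ 0 := by
            apply div_nonpos_of_nonpos_of_nonneg _ hs.le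
            have : 0 ≤ 1 - δ := by linarith
            have : 0 ≤ t ^ 2 * ((1 - δ) + δ ^ 2 + t * (1 - δ)) := by positivity
            linarith
          linarith
    have h4 : 1 ≤ (1 + t) ^ δ * (1 + δ * -(t / (1 + t))) := by
      calc (1 : ℝ) = (1 + t) ^ δ * ((1 + t) ^ δ)⁻¹ := by field_simp
        _ ≤ _ := by gcongr
    linarith
  rw [abs_le]; constructor <;> nlinarith [sq_nonneg t]

/-- Since `2δ ≥ 1`, Bernoulli for a convex power gives the lower bound on the power; squaring the
concave bound `(1 + t)^δ ≤ 1 + δ t` gives the upper one. -/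
theorem abs_one_add_two_mul_sub_rpow_le {δ t : ℝ} (h0 : 1 / 2 ≤ δ) (h1 : δ ≤ 1) (ht : 0 < t) :
    |1 + 2 * δ * t - (1 + t) ^ (2 * δ)| ≤ t ^ 2 := by
  have hlow := one_add_mul_self_le_rpow_one_add (s := t) (by linarith) (p := 2 * δ) (by linarith)
  have hup := rpow_one_add_le_one_add_mul_self (s := t) (by linarith)
    (by linarith : (0 : ℝ) ≤ δ) h1
  have hs : 0 ≤ 1 + t := by linarith
  have hsq : (1 + t) ^ (2 * δ) = ((1 + t) ^ δ) ^ 2 := by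
    rw [← Real.rpow_natCast, ← Real.rpow_mul hs]; congr 1; push_cast; ring
  have hpos : 0 ≤ (1 + t) ^ δ := Real.rpow_nonneg hs δ
  have : (1 + t) ^ (2 * δ) ≤ (1 + δ * t) ^ 2 := by rw [hsq]; gcongr
  have h5 : δ ^ 2 * t ^ 2 ≤ 1 * t ^ 2 := by
    gcongr; nlinarith
  rw [abs_le]; constructor <;> nlinarith [sq_nonneg t]

theorem inv_rpow_sub_inv_rpow_succ_le {δ x : ℝ} (h1 : δ ≤ 1) (hx : 0 < x) :
    (x ^ δ)⁻¹ - ((x + 1) ^ δ)⁻¹ ≤ (x * x ^ δ)⁻¹ := by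
  have hxd : 0 < x ^ δ := Real.rpow_pos_of_pos hx δ
  have hle : (x + 1) ^ δ ≤ x ^ δ * (1 + x⁻¹) := by
    have : x + 1 = x * (1 + x⁻¹) := by field_simp
    rw [this, Real.mul_rpow hx.le (by positivity)]
    gcongr
    calc (1 + x⁻¹) ^ δ ≤ (1 + x⁻¹) ^ (1 : ℝ) :=
          Real.rpow_le_rpow_of_exponent_le (by simp [hx.le]) h1
      _ = _ := Real.rpow_one _
  have h2 : (x ^ δ * (1 + x⁻¹))⁻¹ ≤ ((x + 1) ^ δ)⁻¹ := by gcongr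
  have h3 : (x ^ δ)⁻¹ - (x * x ^ δ)⁻¹ ≤ (x ^ δ * (1 + x⁻¹))⁻¹ := by
    have : (x ^ δ * (1 + x⁻¹))⁻¹ - ((x ^ δ)⁻¹ - (x * x ^ δ)⁻¹) = (x ^ δ * x * (x + 1))⁻¹ := by
      field_simp; ring
    have : 0 < (x ^ δ * x * (x + 1))⁻¹ := by positivity
    linarith
  linarith

/-! ### Deterministic comparison of partial sums with the noise sum -/

/-- The partial sums of a sequence. -/
def partialSum (x : ℕ → ℝ) (n : ℕ) : ℝ := ∑ k ∈ Finset.range n, x k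

/-- The alternating partial sums of a sequence. -/
def altSum (x : ℕ → ℝ) (n : ℕ) : ℝ := ∑ k ∈ Finset.range n, (-1) ^ (k + 1) * x k

/-- The conditional mean of the `n`-th centred step given the earlier ones. -/
noncomputable def drift (δ γ : ℝ) (x : ℕ → ℝ) (n : ℕ) : ℝ :=
  (δ * partialSum x n - γ * (-1) ^ n * altSum x n) / n

/-- The normalised sum of the deviations of the steps from their conditional means. -/
noncomputable def noiseSum (δ γ : ℝ) (x : ℕ → ℝ) (n : ℕ) : ℝ :=
  ∑ k ∈ Finset.range n, (x k - drift δ γ x k) / ((k : ℝ) + 1) ^ δ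

theorem partialSum_succ (x : ℕ → ℝ) (n : ℕ) : partialSum x (n + 1) = partialSum x n + x n :=
  Finset.sum_range_succ _ _

theorem altSum_succ (x : ℕ → ℝ) (n : ℕ) :
    altSum x (n + 1) = altSum x n - (-1) ^ n * x n := by
  rw [altSum, Finset.sum_range_succ, altSum, pow_succ]; ring

theorem noiseSum_succ (δ γ : ℝ) (x : ℕ → ℝ) (n : ℕ) : noiseSum δ γ x (n + 1) =
    noiseSum δ γ x n + (x n - drift δ γ x n) / ((n : ℝ) + 1) ^ δ :=
  Finset.sum_range_succ _ _

theorem abs_partialSum_le {x : ℕ → ℝ} {K : ℝ} (hx : ∀ k, |x k| ≤ K) (n : ℕ) :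
    |partialSum x n| ≤ n * K := by
  refine (Finset.abs_sum_le_sum_abs _ _).trans ?_
  simpa using Finset.sum_le_card_nsmul (Finset.range n) (fun k => |x k|) K (fun k _ => hx k)

theorem abs_altSum_le {x : ℕ → ℝ} {K : ℝ} (hx : ∀ k, |x k| ≤ K) (n : ℕ) :
    |altSum x n| ≤ n * K := by
  refine (Finset.abs_sum_le_sum_abs _ _).trans ?_
  simpa [abs_mul] using
    Finset.sum_le_card_nsmul (Finset.range n) (fun k => |x k|) K (fun k _ => hx k)

theorem abs_drift_le {δ γ : ℝ} (h0 : 0 ≤ δ) (h1 : δ ≤ 1) (hγ : |γ| ≤ 1) {x : ℕ → ℝ} {K : ℝ}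
    (hx : ∀ k, |x k| ≤ K) (n : ℕ) : |drift δ γ x n| ≤ 2 * K := by
  have hK : 0 ≤ K := (abs_nonneg _).trans (hx 0)
  rcases Nat.eq_zero_or_pos n with rfl | hn
  · simp [drift, hK]
  have hn' : (0 : ℝ) < n := by exact_mod_cast hn
  rw [drift, abs_div, abs_of_pos hn', div_le_iff₀ hn']
  have hA := abs_partialSum_le hx n
  have hB := abs_altSum_le hx n
  calc |δ * partialSum x n - γ * (-1) ^ n * altSum x n|
      ≤ |δ * partialSum x n| + |γ * (-1) ^ n * altSum x n| := abs_sub _ _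
    _ = δ * |partialSum x n| + |γ| * |altSum x n| := by
        rw [abs_mul, abs_mul, abs_mul, abs_of_nonneg h0]; simp
    _ ≤ 1 * (n * K) + 1 * (n * K) := by gcongr
    _ = _ := by ring

/-- Pathwise comparison of the normalised partial sums with the noise sum: the difference converges
at a rate that depends only on the bound of the steps. -/
theorem exists_rate_partialSum_sub_noiseSum {δ γ : ℝ} (h0 : 0 < δ) (h1 : δ ≤ 1) (hγ : |γ| ≤ 1 / 2)
    (K : ℝ) : ∃ r : ℕ → ℝ, Tendsto r atTop (𝓝 0) ∧ ∀ x : ℕ → ℝ, (∀ k, |x k| ≤ K) →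
      ∃ l, ∀ n : ℕ, |partialSum x (n + 1) / ((n : ℝ) + 1) ^ δ - noiseSum δ γ x (n + 1) - l| ≤ r n := by
  -- With `n = j + 1`, the increments of `Q` below are at most `(K + 3K/4) n^(-1-δ)`, hence the
  -- factor `2 * K`.
  set D : ℕ → ℝ := fun j => 2 * K * (1 / |(j : ℝ) + 1| ^ (1 + δ)) with hD
  have hDs : Summable D := ((Real.summable_one_div_nat_add_rpow 1 (1 + δ)).2 (by linarith)).mul_left _
  refine ⟨fun n => ∑' m, D (n + m) + K * ((n : ℝ) + 1) ^ (-δ), ?_, fun x hx => ?_⟩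
  · have t1 : Tendsto (fun n => ∑' m, D (n + m)) atTop (𝓝 0) := by
      simpa only [add_comm] using tendsto_sum_nat_add D
    have t2 : Tendsto (fun n : ℕ => K * ((n : ℝ) + 1) ^ (-δ)) atTop (𝓝 (K * 0)) := by
      refine Tendsto.const_mul _ ((tendsto_rpow_neg_atTop h0).comp ?_)
      exact tendsto_atTop_add_const_right _ _ tendsto_natCast_atTop_atTop
    simpa using t1.add t2
  have hK : 0 ≤ K := (abs_nonneg _).trans (hx 0)
  set h : ℕ → ℝ := fun n => altSum x n / (n * ((n : ℝ) + 1) ^ δ) with hh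
  set R : ℕ → ℝ := fun n => partialSum x n / (n : ℝ) ^ δ - noiseSum δ γ x n with hR
  -- The increments of `R` contain `-γ (-1)^n h n`, whose available bound `K n^(-δ)` is not
  -- summable. Taking off half of the oscillating term leaves only differences of consecutive `h`,
  -- of order `n^(-1-δ)`.
  set Q : ℕ → ℝ := fun n => R (n + 1) - γ * ((-1) ^ (n + 1) * h (n + 1) / 2) with hQ
  have hhb : ∀ n : ℕ, |h (n + 1)| ≤ K * ((n : ℝ) + 1) ^ (-δ) := by
    intro n
    have hB := abs_altSum_le hx (n + 1)
    have hp : (0 : ℝ) < ((n : ℝ) + 1) ^ δ := by positivity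
    have hp' : ((n : ℝ) + 1) ^ δ ≤ ((n : ℝ) + 1 + 1) ^ δ := by gcongr; linarith
    have hp2 : (0 : ℝ) < ((n : ℝ) + 1 + 1) ^ δ := by positivity
    have hn : (0 : ℝ) < (n : ℝ) + 1 := by positivity
    rw [Real.rpow_neg hn.le]
    simp only [hh]
    push_cast at hB ⊢
    rw [abs_div, abs_of_pos (mul_pos hn hp2), div_le_iff₀ (mul_pos hn hp2)]
    calc |altSum x (n + 1)| ≤ ((n : ℝ) + 1) * K := hB
      _ = K * (((n : ℝ) + 1) ^ δ)⁻¹ * (((n : ℝ) + 1) * ((n : ℝ) + 1) ^ δ) := by field_simp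
      _ ≤ _ := by gcongr
  have hstep : ∀ j, dist (Q j) (Q j.succ) ≤ D j := by
    intro j
    obtain ⟨n, hn⟩ : ∃ n : ℝ, n = (j : ℝ) + 1 := ⟨_, rfl⟩
    have hnpos : 1 ≤ n := by rw [hn]; linarith [(Nat.cast_nonneg j : (0 : ℝ) ≤ j)]
    have hA := abs_partialSum_le hx (j + 1)
    have hB := abs_altSum_le hx (j + 1)
    have hxn := hx (j + 1)
    have hP : 0 < n ^ δ := by positivity
    have hP1 : 0 < (n + 1) ^ δ := by positivity
    have hP2 : 0 < (n + 1 + 1) ^ δ := by positivity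
    have hPP1 : n ^ δ ≤ (n + 1) ^ δ := by gcongr; linarith
    have hP12 : (n + 1) ^ δ ≤ (n + 1 + 1) ^ δ := by gcongr; linarith
    have hdiff := inv_rpow_sub_inv_rpow_succ_le h1 (by linarith : 0 < n + 1)
    -- The quantity `τ` measures how far `1 + δ/n` is from `((n + 1)/n)^δ`. It is `O(n⁻²)`, and `|A|
    -- ≤ n K`, so the `δ`-part of the drift leaves an error of order `n^(-1-δ)`.
    have htau := abs_one_add_mul_sub_rpow_le h0.le h1 (by positivity : 0 < n⁻¹)
    have hquot : (1 + n⁻¹) ^ δ = (n + 1) ^ δ / n ^ δ := by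
      rw [← Real.div_rpow (by linarith) (by linarith)]; congr 1; field_simp
    rw [hquot] at htau
    obtain ⟨τ, hτ⟩ : ∃ τ, τ = 1 + δ * n⁻¹ - (n + 1) ^ δ / n ^ δ := ⟨_, rfl⟩
    rw [← hτ] at htau
    have he1 : |(-1 : ℝ) ^ (j + 1)| = 1 := by simp
    have hQe : Q (j + 1) - Q j = partialSum x (j + 1) * τ / (n + 1) ^ δ
        - γ * (-1) ^ (j + 1) * ((h (j + 1) - h (j + 2)) / 2) := by
      simp only [hQ, hR]
      have : partialSum x (j + 1 + 1) / (((j + 1 + 1 : ℕ) : ℝ)) ^ δ - noiseSum δ γ x (j + 1 + 1)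
          - (partialSum x (j + 1) / (((j + 1 : ℕ) : ℝ)) ^ δ - noiseSum δ γ x (j + 1))
          = partialSum x (j + 1) * τ / (n + 1) ^ δ - γ * (-1) ^ (j + 1) * h (j + 1) := by
        rw [partialSum_succ, noiseSum_succ]
        simp only [hh, drift]
        push_cast
        rw [← hn, hτ]
        field_simp
        ring
      rw [pow_succ (-1 : ℝ) (j + 1)]
      linear_combination this
    have hterm1 : |partialSum x (j + 1) * τ / (n + 1) ^ δ| ≤ K * (n * n ^ δ)⁻¹ := by
      rw [abs_div, abs_mul, abs_of_pos hP1]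
      have hA' : |partialSum x (j + 1)| ≤ n * K := by rw [hn]; exact_mod_cast hA
      calc |partialSum x (j + 1)| * |τ| / (n + 1) ^ δ ≤ (n * K) * n⁻¹ ^ 2 / n ^ δ := by gcongr
        _ = _ := by field_simp
    have hterm2 : |h (j + 1) - h (j + 2)| ≤ 3 * K * (n * n ^ δ)⁻¹ := by
      have hB' : |altSum x (j + 1)| ≤ n * K := by rw [hn]; exact_mod_cast hB
      have he : h (j + 1) - h (j + 2) = altSum x (j + 1) *
          ((n * (n + 1) ^ δ)⁻¹ - ((n + 1) * (n + 1 + 1) ^ δ)⁻¹)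
          + (-1) ^ (j + 1) * x (j + 1) * ((n + 1) * (n + 1 + 1) ^ δ)⁻¹ := by
        have hc : ((j + 1 : ℕ) : ℝ) = n := by rw [hn]; push_cast; ring
        have hc2 : ((j + 2 : ℕ) : ℝ) = n + 1 := by rw [hn]; push_cast; ring
        simp only [hh]
        rw [altSum_succ x (j + 1), hc, hc2]
        field_simp
        ring
      have hmono : ((n + 1) * (n + 1 + 1) ^ δ)⁻¹ ≤ (n * (n + 1) ^ δ)⁻¹ := by
        gcongr; linarith
      have hle2 : ((n + 1) * (n + 1 + 1) ^ δ)⁻¹ ≤ (n * n ^ δ)⁻¹ := by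
        gcongr <;> linarith
      have hle3 : ((n + 1) * (n + 1) ^ δ)⁻¹ ≤ (n * n ^ δ)⁻¹ := by
        gcongr; linarith
      have hmain : n * ((n * (n + 1) ^ δ)⁻¹ - ((n + 1) * (n + 1 + 1) ^ δ)⁻¹)
          ≤ 2 * (n * n ^ δ)⁻¹ := by
        have : n * ((n * (n + 1) ^ δ)⁻¹ - ((n + 1) * (n + 1 + 1) ^ δ)⁻¹)
          = (((n + 1) ^ δ)⁻¹ - ((n + 1 + 1) ^ δ)⁻¹) + ((n + 1) * (n + 1 + 1) ^ δ)⁻¹ := by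
          field_simp; ring
        rw [this]; linarith
      rw [he]
      calc _ ≤ |altSum x (j + 1) *
          ((n * (n + 1) ^ δ)⁻¹ - ((n + 1) * (n + 1 + 1) ^ δ)⁻¹)|
          + |(-1) ^ (j + 1) * x (j + 1) * ((n + 1) * (n + 1 + 1) ^ δ)⁻¹| := abs_add_le _ _
        _ = |altSum x (j + 1)| * ((n * (n + 1) ^ δ)⁻¹ - ((n + 1) * (n + 1 + 1) ^ δ)⁻¹)
          + |x (j + 1)| * ((n + 1) * (n + 1 + 1) ^ δ)⁻¹ := by
            rw [abs_mul, abs_mul, abs_mul, he1, one_mul,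
              abs_of_nonneg (sub_nonneg.2 hmono),
              abs_of_pos (by positivity : 0 < ((n + 1) * (n + 1 + 1) ^ δ)⁻¹)]
        _ ≤ n * K * ((n * (n + 1) ^ δ)⁻¹ - ((n + 1) * (n + 1 + 1) ^ δ)⁻¹)
          + K * (n * n ^ δ)⁻¹ := by
            gcongr
        _ = K * (n * ((n * (n + 1) ^ δ)⁻¹ - ((n + 1) * (n + 1 + 1) ^ δ)⁻¹))
          + K * (n * n ^ δ)⁻¹ := by ring
        _ ≤ K * (2 * (n * n ^ δ)⁻¹) + K * (n * n ^ δ)⁻¹ := by gcongr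
        _ = _ := by ring
    have hDj : D j = 2 * K * (n * n ^ δ)⁻¹ := by
      simp only [hD]
      rw [← hn, abs_of_pos (by linarith), Real.rpow_add (by linarith), Real.rpow_one, one_div]
    rw [dist_comm, Real.dist_eq, hDj, Nat.succ_eq_add_one, hQe]
    calc _ ≤ |partialSum x (j + 1) * τ / (n + 1) ^ δ|
        + |γ * (-1) ^ (j + 1) * ((h (j + 1) - h (j + 2)) / 2)| := abs_sub _ _
      _ = |partialSum x (j + 1) * τ / (n + 1) ^ δ| + |γ| * (|h (j + 1) - h (j + 2)| / 2) := by
          rw [abs_mul, abs_mul, he1, abs_div (h (j + 1) - h (j + 2))]; simp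
      _ ≤ K * (n * n ^ δ)⁻¹ + 1 / 2 * (3 * K * (n * n ^ δ)⁻¹ / 2) := by gcongr
      _ ≤ _ := by
          have : 0 ≤ K * (n * n ^ δ)⁻¹ := by positivity
          linarith
  -- The distance of `Q n` to its limit is at most a tail of `D`, which does not depend on `x`;
  -- undoing the correction by `h` costs a further `K (n + 1)^(-δ)`.
  obtain ⟨l, hl⟩ := cauchySeq_tendsto_of_complete (cauchySeq_of_dist_le_of_summable D hstep hDs)
  refine ⟨l, fun n => ?_⟩
  have h3 := dist_le_tsum_of_dist_le_of_tendsto D hstep hDs hl n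
  rw [Real.dist_eq] at h3
  have h4 := hhb n
  have he : partialSum x (n + 1) / ((n : ℝ) + 1) ^ δ - noiseSum δ γ x (n + 1) - l
      = (Q n - l) + γ * ((-1) ^ (n + 1) * h (n + 1) / 2) := by
    simp only [hQ, hR]; push_cast; ring
  rw [he]
  refine (abs_add_le _ _).trans (add_le_add h3 ?_)
  rw [abs_mul, abs_div, abs_mul]
  simp only [abs_pow, abs_neg, abs_one, one_pow, one_mul, abs_two]
  calc |γ| * (|h (n + 1)| / 2) ≤ 1 * |h (n + 1)| := by
        gcongr
        · linarith
        · linarith [abs_nonneg (h (n + 1))]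
    _ ≤ _ := by linarith

/-! ### The second-moment recursion and positivity of the limit -/

/-- The recursion satisfied by the second moments `a`, `b` of the partial and of the alternating
partial sums, and by their mixed moment `c`, when the steps have variance `σ2`. -/
structure IsMomentRecursion (δ γ σ2 : ℝ) (a b c : ℕ → ℝ) : Prop where
  zero : a 0 = 0 ∧ b 0 = 0 ∧ c 0 = 0
  succ_a : ∀ n : ℕ, a (n + 1) = a n + 2 * ((δ * a n - γ * (-1) ^ n * c n) / n) + σ2
  succ_b : ∀ n : ℕ, b (n + 1) = b n - 2 * (-1) ^ n * ((δ * c n - γ * (-1) ^ n * b n) / n) + σ2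
  succ_c : ∀ n : ℕ, c (n + 1) = c n - (-1) ^ n * ((δ * a n - γ * (-1) ^ n * c n) / n)
    + (δ * c n - γ * (-1) ^ n * b n) / n - (-1) ^ n * σ2

namespace IsMomentRecursion

variable {δ γ σ2 : ℝ} {a b c : ℕ → ℝ}

/-- This makes the variance of the walk independent of the probability space. Division by `n = 0`
gives `0`, so the recursion also determines the first step. -/
theorem unique (h : IsMomentRecursion δ γ σ2 a b c) {a' b' c' : ℕ → ℝ}
    (h' : IsMomentRecursion δ γ σ2 a' b' c') (n : ℕ) : a n = a' n ∧ b n = b' n ∧ c n = c' n := by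
  induction n with
  | zero =>
    obtain ⟨h1, h2, h3⟩ := h.zero
    obtain ⟨h1', h2', h3'⟩ := h'.zero
    simp [*]
  | succ n ih =>
    obtain ⟨h1, h2, h3⟩ := ih
    rw [h.succ_a, h'.succ_a, h.succ_b, h'.succ_b, h.succ_c, h'.succ_c, h1, h2, h3]
    simp

theorem sum {ι : Type*} (s : Finset ι) {σ2 : ι → ℝ} {a b c : ι → ℕ → ℝ}
    (h : ∀ i ∈ s, IsMomentRecursion δ γ (σ2 i) (a i) (b i) (c i)) :
    IsMomentRecursion δ γ (∑ i ∈ s, σ2 i) (fun n => ∑ i ∈ s, a i n) (fun n => ∑ i ∈ s, b i n)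
      (fun n => ∑ i ∈ s, c i n) where
  zero := ⟨Finset.sum_eq_zero fun i hi => (h i hi).zero.1,
    Finset.sum_eq_zero fun i hi => (h i hi).zero.2.1,
    Finset.sum_eq_zero fun i hi => (h i hi).zero.2.2⟩
  succ_a n := by
    rw [Finset.sum_congr rfl fun i hi => (h i hi).succ_a n]
    simp only [Finset.sum_add_distrib, Finset.sum_sub_distrib, ← Finset.mul_sum, ← Finset.sum_div]
  succ_b n := by
    rw [Finset.sum_congr rfl fun i hi => (h i hi).succ_b n]
    simp only [Finset.sum_add_distrib, Finset.sum_sub_distrib, ← Finset.mul_sum, ← Finset.sum_div]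
  succ_c n := by
    rw [Finset.sum_congr rfl fun i hi => (h i hi).succ_c n]
    simp only [Finset.sum_add_distrib, Finset.sum_sub_distrib, ← Finset.mul_sum, ← Finset.sum_div]

/-- Cauchy–Schwarz, read off from the nonnegative quadratic form at `u = n²`, `v = ± n^(1+δ)`; these
weights make the bounds for the two square terms equal. -/
theorem abs_mixed_le
    (hform : ∀ n u v, 0 ≤ u ^ 2 * a n + 2 * u * v * c n + v ^ 2 * b n)
    {K : ℝ} (hb : ∀ n : ℕ, b n ≤ K * (n : ℝ) ^ 2)
    (ha : ∀ n : ℕ, a n ≤ K * (n : ℝ) ^ (2 * δ)) {n : ℕ} (hn : 1 ≤ n) :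
    |c n| ≤ K * (n : ℝ) ^ (1 + δ) := by
  have hn' : (0 : ℝ) < n := by exact_mod_cast hn
  obtain ⟨t, ht⟩ : ∃ t : ℝ, t = (n : ℝ) ^ (1 + δ) := ⟨_, rfl⟩
  have htp : 0 < t := by rw [ht]; positivity
  have e1 : (n : ℝ) ^ (2 * δ) * (n : ℝ) ^ 2 = t ^ 2 := by
    rw [ht, ← Real.rpow_natCast, ← Real.rpow_natCast, ← Real.rpow_mul hn'.le,
      ← Real.rpow_add hn']
    congr 1; push_cast; ring
  have key : ∀ s : ℝ, s ^ 2 = 1 → -(s * c n) ≤ K * t := by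
    intro s hs
    have h1 := hform n ((n : ℝ) ^ 2) (s * t)
    have h2 : ((n : ℝ) ^ 2) ^ 2 * a n ≤ (n : ℝ) ^ 2 * (K * t ^ 2) := by
      calc ((n : ℝ) ^ 2) ^ 2 * a n ≤ ((n : ℝ) ^ 2) ^ 2 * (K * (n : ℝ) ^ (2 * δ)) := by
            gcongr; exact ha n
        _ = (n : ℝ) ^ 2 * (K * ((n : ℝ) ^ (2 * δ) * (n : ℝ) ^ 2)) := by ring
        _ = _ := by rw [e1]
    have h3 : (s * t) ^ 2 * b n ≤ t ^ 2 * (K * (n : ℝ) ^ 2) := by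
      rw [mul_pow, hs, one_mul]; gcongr; exact hb n
    have h4 : (n : ℝ) ^ 2 * t * (-(s * c n)) ≤ (n : ℝ) ^ 2 * t * (K * t) := by nlinarith
    exact le_of_mul_le_mul_left h4 (by positivity)
  rw [← ht, abs_le]
  constructor
  · linarith [key 1 (by norm_num)]
  · linarith [key (-1) (by norm_num)]

/-- The trivial bound `b = O(n²)` is not enough for `limit_pos` and is improved here. In `b (n+1) =
(1 + 2γ/n) b n - 2δ (-1)^n c n / n + σ²` the factor is at most `1 + 1/n` as `γ ≤ 1/2`, and the
source is `O(n^δ)` by `abs_mixed_le`; both fit under growth `n^(1+δ)`. -/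
theorem exists_alt_le (h : IsMomentRecursion δ γ σ2 a b c) (hδ : 1 / 2 < δ) (hδ1 : δ < 1)
    (hform : ∀ n u v, 0 ≤ u ^ 2 * a n + 2 * u * v * c n + v ^ 2 * b n)
    (hγ : |γ| ≤ 1 / 2) (hσ : 0 ≤ σ2) {K : ℝ}
    (hb : ∀ n : ℕ, b n ≤ K * (n : ℝ) ^ 2) (ha : ∀ n : ℕ, a n ≤ K * (n : ℝ) ^ (2 * δ)) :
    ∃ K', ∀ n : ℕ, 1 ≤ n → b n ≤ K' * (n : ℝ) ^ (1 + δ) := by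
  have hb0 : ∀ n, 0 ≤ b n := fun n => by simpa using hform n 0 1
  have hK : 0 ≤ K := by simpa using (hb0 1).trans (hb 1)
  -- The term `b 1` serves the base case. The induction step needs `2K + σ2 ≤ δ K'`, which holds
  -- since `δ > 1/2`.
  refine ⟨b 1 + 2 * (2 * K + σ2), fun n hn => ?_⟩
  induction n, hn using Nat.le_induction with
  | base => simp; linarith
  | succ n hn ih =>
    obtain ⟨K', hK'⟩ : ∃ K', K' = b 1 + 2 * (2 * K + σ2) := ⟨_, rfl⟩
    rw [← hK'] at ih ⊢
    have hK'0 : 0 ≤ K' := by have := hb0 1; rw [hK']; linarith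
    have hn' : (1 : ℝ) ≤ n := by exact_mod_cast hn
    have hn0 : (0 : ℝ) < n := by linarith
    have hc := abs_mixed_le hform hb ha hn
    have he2 : ((-1 : ℝ) ^ n) ^ 2 = 1 := by rw [← pow_mul, mul_comm, pow_mul]; simp
    obtain ⟨t, ht⟩ : ∃ t : ℝ, t = (n : ℝ) ^ δ := ⟨_, rfl⟩
    have ht1 : 1 ≤ t := by rw [ht]; exact Real.one_le_rpow hn' (by linarith)
    have e1 : (n : ℝ) ^ (1 + δ) = n * t := by rw [Real.rpow_add hn0, Real.rpow_one, ht]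
    rw [e1] at hc ih
    have hpow : (n : ℝ) * t + (1 + δ) * t ≤ ((n : ℝ) + 1) ^ (1 + δ) := by
      have h1 := one_add_mul_self_le_rpow_one_add (s := (n : ℝ)⁻¹) (by
        have : 0 < (n : ℝ)⁻¹ := by positivity
        linarith) (p := 1 + δ) (by linarith)
      have h2 : (n : ℝ) + 1 = n * (1 + (n : ℝ)⁻¹) := by field_simp
      rw [h2, Real.mul_rpow hn0.le (by positivity), e1]
      calc (n : ℝ) * t + (1 + δ) * t = n * t * (1 + (1 + δ) * (n : ℝ)⁻¹) := by field_simp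
        _ ≤ _ := by gcongr
    have hcn : -((-1) ^ n * c n) ≤ |c n| := by
      calc -((-1) ^ n * c n) ≤ |(-1) ^ n * c n| := neg_le_abs _
        _ = |c n| := by rw [abs_mul]; simp
    have hγ' : γ ≤ 1 / 2 := (le_abs_self _).trans hγ
    have hstep : b (n + 1) = b n + 2 * δ * (-((-1) ^ n * c n)) / n + 2 * γ * b n / n + σ2 := by
      rw [h.succ_b]
      linear_combination (2 * γ * b n / n) * he2
    have h1 : 2 * δ * (-((-1) ^ n * c n)) / n ≤ 2 * K * t := by
      rw [div_le_iff₀ hn0]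
      calc 2 * δ * (-((-1) ^ n * c n)) ≤ 2 * 1 * (K * (n * t)) := by
            have : 0 ≤ K * (n * t) := by positivity
            nlinarith
        _ = _ := by ring
    have h2 : 2 * γ * b n / n ≤ K' * t := by
      rw [div_le_iff₀ hn0]
      have := hb0 n
      nlinarith
    push_cast
    calc b (n + 1) ≤ K' * (n * t) + 2 * K * t + K' * t + σ2 * t := by
          rw [hstep]; nlinarith
      _ ≤ K' * ((n : ℝ) * t + (1 + δ) * t) := by
          have : 2 * (2 * K + σ2) ≤ K' := by rw [hK']; linarith [hb0 1]
          have : 1 * K' ≤ 2 * δ * K' := by gcongr; linarith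
          have : (2 * K + σ2) * t ≤ δ * K' * t := by gcongr; linarith
          linarith
      _ ≤ _ := by gcongr

/-- The recursion for `a` contains `-2γ (-1)^n c n / n`, which is too large to be an error. Since
`(-1)^n` changes sign at each step while `c n / n` moves slowly, subtracting `γ (-1)^n c n / n` from
`a n` absorbs it. Every coefficient left on `a`, `b`, `c` is `O(n⁻²)`, so moments bounded by `W n²`
contribute a multiple of `W`. -/
theorem abs_corrected_step_le (h : IsMomentRecursion δ γ σ2 a b c) (hδ : 1 / 2 < δ) (hδ1 : δ < 1)
    (hγ : |γ| ≤ 1 / 2) (hσ : 0 ≤ σ2) {W : ℝ} {n : ℕ} (hn : 1 ≤ n)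
    (h1 : |a n| ≤ W * (n : ℝ) ^ 2) (h2 : |b n| ≤ W * (n : ℝ) ^ 2) (h3 : |c n| ≤ W * (n : ℝ) ^ 2) :
    |(a (n + 1) - γ * (-1) ^ (n + 1) * c (n + 1) / ((n + 1 : ℕ) : ℝ))
        - (1 + (n : ℝ)⁻¹) ^ (2 * δ) * (a n - γ * (-1) ^ n * c n / n) - σ2|
      ≤ 8 * W + σ2 * (n : ℝ)⁻¹ := by
  have hn1 : (1 : ℝ) ≤ n := by exact_mod_cast hn
  have hn0 : (0 : ℝ) < n := by linarith
  have hW : 0 ≤ W * (n : ℝ) ^ 2 := (abs_nonneg _).trans h1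
  obtain ⟨s, hs⟩ : ∃ s : ℝ, s = (n : ℝ)⁻¹ := ⟨_, rfl⟩
  have hs0 : 0 < s := by rw [hs]; positivity
  have hs1 : s ≤ 1 := by rw [hs]; exact inv_le_one_of_one_le₀ hn1
  have hns : (n : ℝ) * s = 1 := by rw [hs]; field_simp
  have htau := abs_one_add_two_mul_sub_rpow_le hδ.le hδ1.le hs0
  obtain ⟨τ, hτ⟩ : ∃ τ, τ = 1 + 2 * δ * s - (1 + s) ^ (2 * δ) := ⟨_, rfl⟩
  rw [← hτ] at htau
  have hκn : (1 + s) ^ (2 * δ) = 1 + 2 * δ * s - τ := by rw [hτ]; ring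
  have he2 : ((-1 : ℝ) ^ n) ^ 2 = 1 := by rw [← pow_mul, mul_comm, pow_mul]; simp
  have he1 : |(-1 : ℝ) ^ n| = 1 := by simp
  obtain ⟨e, he⟩ : ∃ e : ℝ, e = (-1) ^ n := ⟨_, rfl⟩
  obtain ⟨r, hr⟩ : ∃ r : ℝ, r = ((n : ℝ) + 1)⁻¹ := ⟨_, rfl⟩
  have hr0 : 0 < r := by rw [hr]; positivity
  have hrs : r ≤ s := by rw [hr, hs]; gcongr; linarith
  have hrs' : s - r = r * s := by rw [hr, hs]; field_simp; ring
  have hrs2 : r * s ≤ s ^ 2 := by rw [sq]; gcongr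
  have hγδ : |δ + γ| ≤ 2 := by
    have := abs_le.1 hγ
    rw [abs_le]; constructor <;> linarith
  have hexp : (a (n + 1) - γ * (-1) ^ (n + 1) * c (n + 1) / ((n + 1 : ℕ) : ℝ))
      - (1 + s) ^ (2 * δ) * (a n - γ * (-1) ^ n * c n / n) - σ2 =
      a n * (τ - γ * δ * (r * s)) - b n * (γ ^ 2 * (r * s))
      + γ * e * c n * (-(r * s) + (δ + γ) * (r * s) + s * (2 * δ * s - τ)) - γ * r * σ2 := by
    rw [h.succ_a, h.succ_c, hκn, pow_succ]
    push_cast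
    rw [div_eq_mul_inv, div_eq_mul_inv, div_eq_mul_inv, div_eq_mul_inv, ← hr, ← hs, ← he]
    rw [← he] at he2
    linear_combination (γ * r * (σ2 + s * δ * a n - γ * s * e * c n)
      + γ ^ 2 * s * r * b n) * (-he2) + (-γ * e * c n) * hrs'
  rw [← he] at he1
  have hγ1 : |γ| ≤ 1 := by linarith
  have hγ2 : γ ^ 2 ≤ 1 := by rw [← sq_abs]; nlinarith [abs_nonneg γ]
  have t1 : |a n * (τ - γ * δ * (r * s))| ≤ W * (n : ℝ) ^ 2 * (2 * s ^ 2) := by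
    rw [abs_mul]
    gcongr
    calc |τ - γ * δ * (r * s)| ≤ |τ| + |γ * δ * (r * s)| := abs_sub _ _
      _ = |τ| + |γ| * δ * (r * s) := by
        rw [abs_mul, abs_mul, abs_of_pos (by linarith : 0 < δ), abs_of_pos (by positivity : 0 < r * s)]
      _ ≤ s ^ 2 + 1 * 1 * s ^ 2 := by gcongr
      _ = _ := by ring
  have t2 : |b n * (γ ^ 2 * (r * s))| ≤ W * (n : ℝ) ^ 2 * s ^ 2 := by
    rw [abs_mul, abs_of_nonneg (by positivity : 0 ≤ γ ^ 2 * (r * s))]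
    calc |b n| * (γ ^ 2 * (r * s)) ≤ W * (n : ℝ) ^ 2 * (1 * s ^ 2) := by gcongr
      _ = _ := by ring
  have t3 : |γ * e * c n * (-(r * s) + (δ + γ) * (r * s) + s * (2 * δ * s - τ))|
      ≤ W * (n : ℝ) ^ 2 * (3 * s ^ 2) := by
    rw [abs_mul, abs_mul, abs_mul, he1, mul_one]
    have : |-(r * s) + (δ + γ) * (r * s) + s * (2 * δ * s - τ)| ≤ 6 * s ^ 2 := by
      have hrs0 : 0 < r * s := by positivity
      have b1 : |(δ + γ) * (r * s)| ≤ 2 * s ^ 2 := by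
        rw [abs_mul, abs_of_pos hrs0]; gcongr
      have b2 : |s * (2 * δ * s - τ)| ≤ 3 * s ^ 2 := by
        rw [abs_mul, abs_of_pos hs0, sq, mul_left_comm]
        gcongr
        calc |2 * δ * s - τ| ≤ |2 * δ * s| + |τ| := abs_sub _ _
          _ ≤ 2 * 1 * s + s ^ 2 := by
            rw [abs_of_pos (by positivity : 0 < 2 * δ * s)]; gcongr
          _ ≤ 3 * s := by nlinarith
      have b3 := abs_le.1 b1
      have b4 := abs_le.1 b2
      rw [abs_le]; constructor <;> linarith
    calc _ ≤ 1 / 2 * (W * (n : ℝ) ^ 2) * (6 * s ^ 2) := by gcongr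
      _ = _ := by ring
  have t4 : |γ * r * σ2| ≤ σ2 * s := by
    rw [abs_mul, abs_mul, abs_of_nonneg hσ, abs_of_pos hr0]
    calc |γ| * r * σ2 ≤ 1 * s * σ2 := by gcongr
      _ = _ := by ring
  have hcancel : W * (n : ℝ) ^ 2 * s ^ 2 = W := by
    calc W * (n : ℝ) ^ 2 * s ^ 2 = W * (n * s) ^ 2 := by ring
      _ = _ := by rw [hns]; ring
  rw [← hs, hexp]
  have t1' := abs_le.1 t1
  have t2' := abs_le.1 t2
  have t3' := abs_le.1 t3
  have t4' := abs_le.1 t4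
  rw [abs_le]; constructor <;> linarith

theorem limit_pos (h : IsMomentRecursion δ γ σ2 a b c) (hδ : 1 / 2 < δ) (hδ1 : δ < 1)
    (hform : ∀ n u v, 0 ≤ u ^ 2 * a n + 2 * u * v * c n + v ^ 2 * b n)
    (hγ : |γ| ≤ 1 / 2) (hσ : 0 < σ2) {K : ℝ} (hb : ∀ n : ℕ, b n ≤ K * (n : ℝ) ^ 2)
    {C : ℝ} (hC : Tendsto (fun n : ℕ => a n / (n : ℝ) ^ (2 * δ)) atTop (𝓝 C)) : 0 < C := by
  have ha0 : ∀ n, 0 ≤ a n := fun n => by simpa using hform n 1 0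
  have hb0 : ∀ n, 0 ≤ b n := fun n => by simpa using hform n 0 1
  obtain ⟨K1, hK1⟩ := hC.bddAbove_range
  have ha1 : ∀ n : ℕ, a n ≤ max K K1 * (n : ℝ) ^ (2 * δ) := by
    intro n
    rcases Nat.eq_zero_or_pos n with rfl | hn
    · rw [h.zero.1]; simp [Real.zero_rpow (by linarith : 2 * δ ≠ 0)]
    · have hn0 : (0 : ℝ) < n := by exact_mod_cast hn
      rw [← div_le_iff₀ (by positivity)]
      exact (hK1 ⟨n, rfl⟩).trans (le_max_right _ _)
  have hb1 : ∀ n : ℕ, b n ≤ max K K1 * (n : ℝ) ^ 2 := fun n =>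
    (hb n).trans (by gcongr; exact le_max_left _ _)
  obtain ⟨K2, hK2⟩ := exists_alt_le h hδ hδ1 hform hγ hσ.le hb1 ha1
  obtain ⟨M, hM⟩ : ∃ M, M = max (max K K1) K2 := ⟨_, rfl⟩
  have hM0 : 0 ≤ M := by
    have := (hb0 1).trans (hb1 1)
    rw [hM]; simp at this ⊢; tauto
  have hall : ∀ n : ℕ, 1 ≤ n → a n ≤ M * (n : ℝ) ^ (1 + δ) ∧ b n ≤ M * (n : ℝ) ^ (1 + δ) ∧
      |c n| ≤ M * (n : ℝ) ^ (1 + δ) := by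
    intro n hn
    have hn1 : (1 : ℝ) ≤ n := by exact_mod_cast hn
    have hl : max K K1 ≤ M := hM ▸ le_max_left _ _
    have hr : K2 ≤ M := hM ▸ le_max_right _ _
    refine ⟨(ha1 n).trans ?_, (hK2 n hn).trans (by gcongr),
      (abs_mixed_le hform hb1 ha1 hn).trans (by gcongr)⟩
    have : (n : ℝ) ^ (2 * δ) ≤ (n : ℝ) ^ (1 + δ) :=
      Real.rpow_le_rpow_of_exponent_le hn1 (by linarith)
    gcongr
  obtain ⟨z, hz⟩ : ∃ z : ℕ → ℝ, ∀ n, z n = a n - γ * (-1) ^ n * c n / n := ⟨_, fun _ => rfl⟩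
  obtain ⟨κ, hκ⟩ : ∃ κ : ℕ → ℝ, ∀ n : ℕ, κ n = (1 + (n : ℝ)⁻¹) ^ (2 * δ) := ⟨_, fun _ => rfl⟩
  have hdecay : Tendsto (fun n : ℕ => (n : ℝ) ^ (-(1 - δ))) atTop (𝓝 0) :=
    (tendsto_rpow_neg_atTop (by linarith)).comp tendsto_natCast_atTop_atTop
  have hinv : Tendsto (fun n : ℕ => ((n : ℝ))⁻¹) atTop (𝓝 0) := tendsto_inv_atTop_nhds_zero_nat
  have hscale : ∀ n : ℕ, 1 ≤ n → (n : ℝ) ^ (1 + δ) = (n : ℝ) ^ (-(1 - δ)) * (n : ℝ) ^ 2 := by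
    intro n hn
    have hn0 : (0 : ℝ) < n := by exact_mod_cast hn
    rw [← Real.rpow_natCast, ← Real.rpow_add hn0]; congr 1; push_cast; ring
  have hη : ∀ n : ℕ, 1 ≤ n → |z (n + 1) - κ n * z n - σ2| ≤
      8 * M * (n : ℝ) ^ (-(1 - δ)) + σ2 * (n : ℝ)⁻¹ := by
    intro n hn
    obtain ⟨h1, h2, h3⟩ := hall n hn
    rw [hscale n hn, ← mul_assoc] at h1 h2 h3
    rw [hz, hz, hκ, mul_assoc 8 M]
    exact abs_corrected_step_le h hδ hδ1 hγ hσ.le hn (by rwa [abs_of_nonneg (ha0 n)])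
      (by rwa [abs_of_nonneg (hb0 n)]) h3
  have hzlow : ∀ n : ℕ, 1 ≤ n → -(M * (n : ℝ) ^ (-(1 - δ))) ≤ z n := by
    intro n hn
    have hn0 : (0 : ℝ) < n := by exact_mod_cast hn
    have he2 : ((-1 : ℝ) ^ n) ^ 2 = 1 := by rw [← pow_mul, mul_comm, pow_mul]; simp
    -- Completing the square: with this `v` the form equals `z n + v² b n`, so `z n` can be negative
    -- only by `O(b n / n²)`.
    have h1 := hform n 1 (-(γ * (-1) ^ n / (2 * n)))
    have h2 := (hall n hn).2.1
    rw [hscale n hn] at h2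
    have h3 : (-(γ * (-1) ^ n / (2 * n))) ^ 2 * b n ≤ M * (n : ℝ) ^ (-(1 - δ)) := by
      have : (-(γ * (-1) ^ n / (2 * n))) ^ 2 = (γ ^ 2 / 4) / (n : ℝ) ^ 2 := by
        rw [neg_sq, div_pow, mul_pow, he2]; field_simp; norm_num
      rw [this, div_mul_eq_mul_div, div_le_iff₀ (by positivity)]
      have hγ2 : γ ^ 2 / 4 ≤ 1 := by
        have : γ ^ 2 ≤ 1 := by rw [← sq_abs]; nlinarith [abs_nonneg γ]
        linarith
      calc γ ^ 2 / 4 * b n ≤ 1 * b n := by gcongr; exact hb0 n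
        _ ≤ _ := by linarith
    rw [hz]
    have h4 : 2 * 1 * (-(γ * (-1) ^ n / (2 * n))) * c n = -(γ * (-1) ^ n * c n / n) := by
      field_simp
    rw [h4] at h1
    linarith
  have hζ : Tendsto (fun n : ℕ => z n / (n : ℝ) ^ (2 * δ)) atTop (𝓝 C) := by
    have hsmall : Tendsto (fun n : ℕ => γ * (-1) ^ n * c n / n / (n : ℝ) ^ (2 * δ)) atTop (𝓝 0) := by
      have hd2 : Tendsto (fun n : ℕ => M * (n : ℝ) ^ (-δ)) atTop (𝓝 0) := by
        simpa using ((tendsto_rpow_neg_atTop (by linarith : 0 < δ)).comp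
          tendsto_natCast_atTop_atTop).const_mul M
      refine squeeze_zero_norm' ?_ hd2
      filter_upwards [eventually_ge_atTop 1] with n hn
      have hn0 : (0 : ℝ) < n := by exact_mod_cast hn
      rw [Real.norm_eq_abs, abs_div, abs_div, abs_mul, abs_mul, abs_of_pos hn0,
        abs_of_pos (by positivity : 0 < (n : ℝ) ^ (2 * δ)), div_div, div_le_iff₀ (by positivity)]
      have e : (n : ℝ) ^ (-δ) * (n * (n : ℝ) ^ (2 * δ)) = (n : ℝ) ^ (1 + δ) := by
        rw [← Real.rpow_one_add' hn0.le (by linarith), ← Real.rpow_add hn0]; congr 1; ring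
      calc |γ| * |(-1) ^ n| * |c n| ≤ 1 * (M * (n : ℝ) ^ (1 + δ)) := by
            simp only [abs_pow, abs_neg, abs_one, one_pow, mul_one]
            gcongr
            · linarith
            · exact (hall n hn).2.2
        _ = M * (n : ℝ) ^ (-δ) * (n * (n : ℝ) ^ (2 * δ)) := by rw [mul_assoc M, e, one_mul]
    have := hC.sub hsmall
    rw [sub_zero] at this
    refine this.congr fun n => ?_
    rw [hz]; ring
  -- Here `12 = 8 + 4`: the `8` is the error in `hη`, and the `4` pays for `κ N * z N`, using `κ N ≤
  -- 4` and the lower bound `hzlow`. Beyond `N` the variance `σ2` outweighs both, which gives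
  -- monotonicity and a positive value at `N + 1`.
  have hlim : Tendsto (fun n : ℕ => 12 * M * (n : ℝ) ^ (-(1 - δ)) + σ2 * (n : ℝ)⁻¹) atTop (𝓝 0) := by
    simpa using (hdecay.const_mul (12 * M)).add (hinv.const_mul σ2)
  obtain ⟨N, hN⟩ := eventually_atTop.1 ((hlim.eventually_lt_const hσ).and (eventually_ge_atTop 1))
  have hpow : ∀ n : ℕ, 1 ≤ n → ((n : ℝ) + 1) ^ (2 * δ) = κ n * (n : ℝ) ^ (2 * δ) := by
    intro n hn
    have hn0 : (0 : ℝ) < n := by exact_mod_cast hn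
    rw [hκ, ← Real.mul_rpow (by positivity) hn0.le]; congr 1; field_simp
  have hinc : ∀ n, N ≤ n → z n / (n : ℝ) ^ (2 * δ) ≤ z (n + 1) / ((n + 1 : ℕ) : ℝ) ^ (2 * δ) := by
    intro n hn
    obtain ⟨h1, h2⟩ := hN n hn
    have hn0 : (0 : ℝ) < n := by exact_mod_cast h2
    have h3 := abs_le.1 (hη n h2)
    have hu0 : 0 ≤ M * (n : ℝ) ^ (-(1 - δ)) := by positivity
    have hκ0 : 0 < κ n := by rw [hκ]; positivity
    push_cast
    rw [hpow n h2, div_le_div_iff₀ (by positivity) (by positivity)]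
    have : κ n * z n ≤ z (n + 1) := by linarith
    calc z n * (κ n * (n : ℝ) ^ (2 * δ)) = (κ n * z n) * (n : ℝ) ^ (2 * δ) := by ring
      _ ≤ _ := by gcongr
  have hposN : 0 < z (N + 1) / ((N + 1 : ℕ) : ℝ) ^ (2 * δ) := by
    obtain ⟨h1, h2⟩ := hN N le_rfl
    have h3 := abs_le.1 (hη N h2)
    have hn1 : (1 : ℝ) ≤ N := by exact_mod_cast h2
    have hu0 : 0 ≤ M * (N : ℝ) ^ (-(1 - δ)) := by positivity
    have hκ4 : κ N ≤ 4 := by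
      rw [hκ]
      calc (1 + (N : ℝ)⁻¹) ^ (2 * δ) ≤ (1 + (N : ℝ)⁻¹) ^ (2 : ℝ) := by
            apply Real.rpow_le_rpow_of_exponent_le _ (by linarith)
            have : 0 ≤ (N : ℝ)⁻¹ := by positivity
            linarith
        _ ≤ (1 + 1 : ℝ) ^ (2 : ℝ) := by
            gcongr; exact inv_le_one_of_one_le₀ hn1
        _ = 4 := by norm_num
    have hκ0 : 0 < κ N := by rw [hκ]; positivity
    have h5 := hzlow N h2
    have : -(4 * (M * (N : ℝ) ^ (-(1 - δ)))) ≤ κ N * z N := by nlinarith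
    apply div_pos
    · linarith
    · positivity
  refine hposN.trans_le ?_
  have hmono : ∀ n, N + 1 ≤ n → z (N + 1) / ((N + 1 : ℕ) : ℝ) ^ (2 * δ) ≤ z n / (n : ℝ) ^ (2 * δ) := by
    intro n hn
    induction n, hn using Nat.le_induction with
    | base => exact le_rfl
    | succ n hn ih => exact ih.trans (hinc n (by omega))
  exact ge_of_tendsto hζ (eventually_atTop.2 ⟨N + 1, hmono⟩)

end IsMomentRecursion

/-! ### Bounded measurable functions -/

/-- Bounded real functions that are measurable with respect to a given σ-field. -/
def IsBddMeas {Ω : Type*} (m : MeasurableSpace Ω) (f : Ω → ℝ) : Prop :=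
  Measurable[m] f ∧ ∃ M, ∀ ω, |f ω| ≤ M

namespace IsBddMeas

variable {Ω : Type*} {m m' : MeasurableSpace Ω} {f g : Ω → ℝ}

theorem mono (hf : IsBddMeas m f) (h : m ≤ m') : IsBddMeas m' f := ⟨hf.1.mono h le_rfl, hf.2⟩

theorem const (r : ℝ) : IsBddMeas m (fun _ => r) := ⟨measurable_const, |r|, fun _ => le_rfl⟩

theorem add (hf : IsBddMeas m f) (hg : IsBddMeas m g) : IsBddMeas m (fun ω => f ω + g ω) := by
  obtain ⟨hf, M, hM⟩ := hf
  obtain ⟨hg, N, hN⟩ := hg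
  exact ⟨hf.add hg, M + N, fun ω => (abs_add_le _ _).trans (add_le_add (hM ω) (hN ω))⟩

theorem mul (hf : IsBddMeas m f) (hg : IsBddMeas m g) : IsBddMeas m (fun ω => f ω * g ω) := by
  obtain ⟨hf, M, hM⟩ := hf
  obtain ⟨hg, N, hN⟩ := hg
  refine ⟨hf.mul hg, M * N, fun ω => ?_⟩
  rw [abs_mul]
  exact mul_le_mul (hM ω) (hN ω) (abs_nonneg _) ((abs_nonneg _).trans (hM ω))

theorem const_mul (hf : IsBddMeas m f) (r : ℝ) : IsBddMeas m (fun ω => r * f ω) := (const r).mul hf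

theorem sub (hf : IsBddMeas m f) (hg : IsBddMeas m g) : IsBddMeas m (fun ω => f ω - g ω) := by
  simpa [sub_eq_add_neg] using hf.add (hg.const_mul (-1))

theorem div_const (hf : IsBddMeas m f) (r : ℝ) : IsBddMeas m (fun ω => f ω / r) := by
  simpa [div_eq_inv_mul] using hf.const_mul r⁻¹

theorem pow (hf : IsBddMeas m f) (k : ℕ) : IsBddMeas m (fun ω => f ω ^ k) := by
  induction k with
  | zero => simpa using const 1
  | succ k ih => simpa [pow_succ] using ih.mul hf

theorem sum {ι : Type*} (s : Finset ι) {f : ι → Ω → ℝ} (h : ∀ i ∈ s, IsBddMeas m (f i)) :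
    IsBddMeas m (fun ω => ∑ i ∈ s, f i ω) := by
  classical
  induction s using Finset.induction_on with
  | empty => simpa using const 0
  | insert i s his ih =>
    simp only [Finset.sum_insert his]
    exact (h i (by simp)).add (ih fun j hj => h j (by simp [hj]))

theorem integrable {P : Measure[m'] Ω} [IsFiniteMeasure P] (hf : IsBddMeas m f) (h : m ≤ m') :
    Integrable f P := by
  obtain ⟨hf, M, hM⟩ := hf
  exact Integrable.of_bound (hf.mono h le_rfl).aestronglyMeasurable M (ae_of_all _ hM)

theorem memLp {P : Measure[m'] Ω} [IsFiniteMeasure P] (hf : IsBddMeas m f) (h : m ≤ m')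
    (p : ENNReal) : MemLp f p P := by
  obtain ⟨hf, M, hM⟩ := hf
  exact MemLp.of_bound (hf.mono h le_rfl).aestronglyMeasurable M (ae_of_all _ hM)

end IsBddMeas

/-! ### Bounded sequences with linear drift: moments, martingale and limit -/

section

variable {Ω : Type*} {mΩ : MeasurableSpace Ω}

/-- A bounded adapted sequence of centred steps with constant variance `σ2` whose conditional means
given the past are `drift δ γ`. -/
structure IsDriftSequence (δ γ K σ2 : ℝ) (P : Measure Ω) (ℱ : Filtration ℕ mΩ) (x : ℕ → Ω → ℝ) :
    Prop where
  measurable : ∀ n, Measurable[ℱ (n + 1)] (x n)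
  bound : ∀ n ω, |x n ω| ≤ K
  integral_mul : ∀ n f, IsBddMeas (ℱ n) f →
    ∫ ω, f ω * x n ω ∂P = ∫ ω, f ω * drift δ γ (fun k => x k ω) n ∂P
  integral_sq : ∀ n, ∫ ω, x n ω ^ 2 ∂P = σ2

namespace IsDriftSequence

variable {δ γ K σ2 : ℝ} {P : Measure Ω} {ℱ : Filtration ℕ mΩ}
  {x : ℕ → Ω → ℝ}

theorem isBddMeas_step (h : IsDriftSequence δ γ K σ2 P ℱ x) {k n : ℕ} (hkn : k < n) :
    IsBddMeas (ℱ n) (x k) :=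
  ⟨(h.measurable k).mono (ℱ.mono hkn) le_rfl, K, h.bound k⟩

theorem isBddMeas_partialSum (h : IsDriftSequence δ γ K σ2 P ℱ x) (n : ℕ) :
    IsBddMeas (ℱ n) (fun ω => partialSum (fun k => x k ω) n) :=
  IsBddMeas.sum _ fun _ hk => h.isBddMeas_step (Finset.mem_range.1 hk)

theorem isBddMeas_altSum (h : IsDriftSequence δ γ K σ2 P ℱ x) (n : ℕ) :
    IsBddMeas (ℱ n) (fun ω => altSum (fun k => x k ω) n) :=
  IsBddMeas.sum _ fun _ hk => (h.isBddMeas_step (Finset.mem_range.1 hk)).const_mul _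

theorem isBddMeas_drift (h : IsDriftSequence δ γ K σ2 P ℱ x) (n : ℕ) :
    IsBddMeas (ℱ n) (fun ω => drift δ γ (fun k => x k ω) n) :=
  (((h.isBddMeas_partialSum n).const_mul δ).sub
    ((h.isBddMeas_altSum n).const_mul (γ * (-1) ^ n))).div_const _

theorem isBddMeas_noiseSum (h : IsDriftSequence δ γ K σ2 P ℱ x) (n : ℕ) :
    IsBddMeas (ℱ n) (fun ω => noiseSum δ γ (fun k => x k ω) n) :=
  IsBddMeas.sum _ fun k hk => ((h.isBddMeas_step (Finset.mem_range.1 hk)).sub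
    ((h.isBddMeas_drift k).mono (ℱ.mono (Finset.mem_range.1 hk).le))).div_const _

/-! ### Second moments -/

/-- The system closes because `A` and `B` are known at time `n`: in their products with `x n` the
step may be replaced by its drift, which is linear in `A` and `B`. -/
theorem isMomentRecursion [IsProbabilityMeasure P] (h : IsDriftSequence δ γ K σ2 P ℱ x) :
    IsMomentRecursion δ γ σ2 (fun n => ∫ ω, partialSum (fun k => x k ω) n ^ 2 ∂P)
      (fun n => ∫ ω, altSum (fun k => x k ω) n ^ 2 ∂P)
      (fun n => ∫ ω, partialSum (fun k => x k ω) n * altSum (fun k => x k ω) n ∂P) := by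
  have hI : ∀ n {f : Ω → ℝ}, IsBddMeas (ℱ n) f → Integrable f P :=
    fun n f hf => hf.integrable (ℱ.le n)
  have hA := h.isBddMeas_partialSum
  have hB := h.isBddMeas_altSum
  have hX : ∀ n, IsBddMeas (ℱ (n + 1)) (x n) := fun n => h.isBddMeas_step (Nat.lt_succ_self n)
  have hA' : ∀ n, IsBddMeas (ℱ (n + 1)) (fun ω => partialSum (fun k => x k ω) n) :=
    fun n => (hA n).mono (ℱ.mono n.le_succ)
  have hB' : ∀ n, IsBddMeas (ℱ (n + 1)) (fun ω => altSum (fun k => x k ω) n) :=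
    fun n => (hB n).mono (ℱ.mono n.le_succ)
  have hAx : ∀ n, ∫ ω, partialSum (fun k => x k ω) n * x n ω ∂P =
      (δ * ∫ ω, partialSum (fun k => x k ω) n ^ 2 ∂P - γ * (-1) ^ n *
        ∫ ω, partialSum (fun k => x k ω) n * altSum (fun k => x k ω) n ∂P) / n := by
    intro n
    rw [h.integral_mul n _ (hA n), ← integral_const_mul, ← integral_const_mul,
      ← integral_sub (hI n (((hA n).pow 2).const_mul _)) (hI n (((hA n).mul (hB n)).const_mul _)),
      ← integral_div]
    congr 1; ext ω; rw [drift]; ring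
  have hBx : ∀ n, ∫ ω, altSum (fun k => x k ω) n * x n ω ∂P =
      (δ * ∫ ω, partialSum (fun k => x k ω) n * altSum (fun k => x k ω) n ∂P - γ * (-1) ^ n *
        ∫ ω, altSum (fun k => x k ω) n ^ 2 ∂P) / n := by
    intro n
    rw [h.integral_mul n _ (hB n), ← integral_const_mul, ← integral_const_mul,
      ← integral_sub (hI n (((hA n).mul (hB n)).const_mul _)) (hI n (((hB n).pow 2).const_mul _)),
      ← integral_div]
    congr 1; ext ω; rw [drift]; ring
  refine ⟨by simp [partialSum, altSum], fun n => ?_, fun n => ?_, fun n => ?_⟩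
  · rw [← hAx, ← h.integral_sq n, ← integral_const_mul,
      ← integral_add (hI _ ((hA n).pow 2)) (hI _ (((hA' n).mul (hX n)).const_mul _)),
      ← integral_add (hI _ (((hA' n).pow 2).add (((hA' n).mul (hX n)).const_mul _)))
        (hI _ ((hX n).pow 2))]
    congr 1; ext ω; rw [partialSum_succ]; ring
  · rw [← hBx, ← h.integral_sq n, ← integral_const_mul,
      ← integral_sub (hI _ ((hB n).pow 2)) (hI _ (((hB' n).mul (hX n)).const_mul _)),
      ← integral_add (hI _ (((hB' n).pow 2).sub (((hB' n).mul (hX n)).const_mul _)))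
        (hI _ ((hX n).pow 2))]
    congr 1; ext ω; rw [altSum_succ]
    have he2 : ((-1 : ℝ) ^ n) ^ 2 = 1 := by rw [← pow_mul, mul_comm, pow_mul]; simp
    linear_combination (x n ω) ^ 2 * he2
  · rw [← hBx, ← hAx, ← h.integral_sq n, ← integral_const_mul, ← integral_const_mul,
      ← integral_sub (hI _ ((hA n).mul (hB n))) (hI _ (((hA' n).mul (hX n)).const_mul _)),
      ← integral_add (hI _ (((hA' n).mul (hB' n)).sub (((hA' n).mul (hX n)).const_mul _)))
        (hI _ ((hB' n).mul (hX n))),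
      ← integral_sub (hI _ ((((hA' n).mul (hB' n)).sub (((hA' n).mul (hX n)).const_mul _)).add
        ((hB' n).mul (hX n)))) (hI _ (((hX n).pow 2).const_mul _))]
    congr 1; ext ω; rw [altSum_succ, partialSum_succ]; ring

theorem moment_form_nonneg [IsProbabilityMeasure P] (h : IsDriftSequence δ γ K σ2 P ℱ x) (n : ℕ)
    (u v : ℝ) :
    0 ≤ u ^ 2 * ∫ ω, partialSum (fun k => x k ω) n ^ 2 ∂P
      + 2 * u * v * ∫ ω, partialSum (fun k => x k ω) n * altSum (fun k => x k ω) n ∂P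
      + v ^ 2 * ∫ ω, altSum (fun k => x k ω) n ^ 2 ∂P := by
  have hI : ∀ {f : Ω → ℝ}, IsBddMeas (ℱ n) f → Integrable f P :=
    fun hf => hf.integrable (ℱ.le n)
  have hA := h.isBddMeas_partialSum n
  have hB := h.isBddMeas_altSum n
  rw [← integral_const_mul, ← integral_const_mul, ← integral_const_mul,
    ← integral_add (hI ((hA.pow 2).const_mul _)) (hI ((hA.mul hB).const_mul _)),
    ← integral_add (hI (((hA.pow 2).const_mul _).add ((hA.mul hB).const_mul _)))
      (hI ((hB.pow 2).const_mul _))]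
  refine integral_nonneg fun ω => ?_
  have : 0 ≤ (u * partialSum (fun k => x k ω) n + v * altSum (fun k => x k ω) n) ^ 2 := sq_nonneg _
  simp only [Pi.zero_apply]
  linarith

theorem integral_altSum_sq_le [IsProbabilityMeasure P] (h : IsDriftSequence δ γ K σ2 P ℱ x)
    (n : ℕ) :
    ∫ ω, altSum (fun k => x k ω) n ^ 2 ∂P ≤ K ^ 2 * (n : ℝ) ^ 2 := by
  have hB := h.isBddMeas_altSum n
  calc ∫ ω, altSum (fun k => x k ω) n ^ 2 ∂P ≤ ∫ _, K ^ 2 * (n : ℝ) ^ 2 ∂P := by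
        refine integral_mono ((hB.pow 2).integrable (ℱ.le n)) (integrable_const _) fun ω => ?_
        have := abs_altSum_le (fun k => h.bound k ω) n
        simp only
        rw [← sq_abs, ← mul_pow, mul_comm K]
        gcongr
    _ = _ := by simp

/-! ### The noise martingale -/

theorem integral_mul_noise [IsProbabilityMeasure P] (h : IsDriftSequence δ γ K σ2 P ℱ x) {n : ℕ}
    {f : Ω → ℝ} (hf : IsBddMeas (ℱ n) f) :
    ∫ ω, f ω * ((x n ω - drift δ γ (fun k => x k ω) n) / ((n : ℝ) + 1) ^ δ) ∂P = 0 := by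
  have h1 := (hf.mono (ℱ.mono n.le_succ)).mul (h.isBddMeas_step n.lt_succ_self)
  have h2 := hf.mul (h.isBddMeas_drift n)
  have : ∀ ω, f ω * ((x n ω - drift δ γ (fun k => x k ω) n) / ((n : ℝ) + 1) ^ δ) =
      (f ω * x n ω - f ω * drift δ γ (fun k => x k ω) n) / ((n : ℝ) + 1) ^ δ := fun ω => by ring
  simp only [this]
  rw [integral_div, integral_sub (h1.integrable (ℱ.le _)) (h2.integrable (ℱ.le _)),
    h.integral_mul n f hf, sub_self, zero_div]

theorem martingale_noiseSum [IsProbabilityMeasure P] (h : IsDriftSequence δ γ K σ2 P ℱ x) :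
    Martingale (fun n ω => noiseSum δ γ (fun k => x k ω) n) ℱ P := by
  refine martingale_of_setIntegral_eq_succ (fun n => (h.isBddMeas_noiseSum n).1.stronglyMeasurable)
    (fun n => (h.isBddMeas_noiseSum n).integrable (ℱ.le n)) fun n s hs => ?_
  have hsm := ℱ.le n s hs
  have hf : IsBddMeas (ℱ n) (s.indicator fun _ => (1 : ℝ)) := by
    refine ⟨measurable_const.indicator hs, 1, fun ω => ?_⟩
    by_cases hω : ω ∈ s <;> simp [hω]
  have h0 := h.integral_mul_noise hf
  have hd : IsBddMeas (ℱ (n + 1)) fun ω =>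
      (x n ω - drift δ γ (fun k => x k ω) n) / ((n : ℝ) + 1) ^ δ :=
    ((h.isBddMeas_step n.lt_succ_self).sub
      ((h.isBddMeas_drift n).mono (ℱ.mono n.le_succ))).div_const _
  have h1 : ∫ ω in s, (x n ω - drift δ γ (fun k => x k ω) n) / ((n : ℝ) + 1) ^ δ ∂P = 0 := by
    rw [← integral_indicator hsm, ← h0]
    congr 1; ext ω
    by_cases hω : ω ∈ s <;> simp [hω]
  simp only [noiseSum_succ]
  rw [integral_add ((h.isBddMeas_noiseSum n).integrable (ℱ.le n)).integrableOn
    (hd.integrable (ℱ.le _)).integrableOn, h1, add_zero]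

/-- Martingale increments are orthogonal, so their second moments add up. Each deviation is at most
`K + 2K`, the sum of the bounds for the step and for its drift. -/
theorem integral_noiseSum_sub_sq_le [IsProbabilityMeasure P]
    (h : IsDriftSequence δ γ K σ2 P ℱ x) (h0 : 0 ≤ δ) (h1 : δ ≤ 1) (hγ : |γ| ≤ 1) (m j : ℕ) :
    ∫ ω, (noiseSum δ γ (fun k => x k ω) (m + j) - noiseSum δ γ (fun k => x k ω) m) ^ 2 ∂P
      ≤ ∑ i ∈ Finset.range j, (3 * K) ^ 2 * (1 / |((i + m : ℕ) : ℝ) + 1| ^ (2 * δ)) := by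
  induction j with
  | zero => simp
  | succ j ih =>
    set n := m + j with hn
    have hM : IsBddMeas (ℱ n) fun ω =>
        noiseSum δ γ (fun k => x k ω) n - noiseSum δ γ (fun k => x k ω) m :=
      (h.isBddMeas_noiseSum n).sub ((h.isBddMeas_noiseSum m).mono (ℱ.mono (by omega)))
    have hM' := hM.mono (ℱ.mono n.le_succ)
    have hd : IsBddMeas (ℱ (n + 1)) fun ω =>
        (x n ω - drift δ γ (fun k => x k ω) n) / ((n : ℝ) + 1) ^ δ :=
      ((h.isBddMeas_step n.lt_succ_self).sub
        ((h.isBddMeas_drift n).mono (ℱ.mono n.le_succ))).div_const _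
    have hcross := h.integral_mul_noise hM
    have hsq : ∫ ω, ((x n ω - drift δ γ (fun k => x k ω) n) / ((n : ℝ) + 1) ^ δ) ^ 2 ∂P ≤
        (3 * K) ^ 2 * (1 / |((j + m : ℕ) : ℝ) + 1| ^ (2 * δ)) := by
      calc _ ≤ ∫ _, (3 * K) ^ 2 * (1 / |((j + m : ℕ) : ℝ) + 1| ^ (2 * δ)) ∂P := by
            refine integral_mono ((hd.pow 2).integrable (ℱ.le _)) (integrable_const _) fun ω => ?_
            have hb := h.bound n ω
            have hb2 := abs_drift_le h0 h1 hγ (fun k => h.bound k ω) n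
            have hb3 : |x n ω - drift δ γ (fun k => x k ω) n| ≤ 3 * K :=
              (abs_sub _ _).trans (by linarith)
            have hpos : (0 : ℝ) < (n : ℝ) + 1 := by positivity
            have he : |((j + m : ℕ) : ℝ) + 1| ^ (2 * δ) = (((n : ℝ) + 1) ^ δ) ^ 2 := by
              rw [add_comm j m, ← hn, abs_of_pos hpos, ← Real.rpow_natCast, ← Real.rpow_mul hpos.le]
              congr 1; push_cast; ring
            simp only
            rw [he, div_pow, div_eq_mul_one_div, ← sq_abs]
            gcongr
        _ = _ := by simp
    rw [Finset.sum_range_succ]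
    refine le_trans (le_of_eq ?_) (add_le_add ih hsq)
    have hexp : ∀ ω, (noiseSum δ γ (fun k => x k ω) (m + (j + 1))
        - noiseSum δ γ (fun k => x k ω) m) ^ 2 =
        ((noiseSum δ γ (fun k => x k ω) n - noiseSum δ γ (fun k => x k ω) m) ^ 2
        + 2 * ((noiseSum δ γ (fun k => x k ω) n - noiseSum δ γ (fun k => x k ω) m) *
          ((x n ω - drift δ γ (fun k => x k ω) n) / ((n : ℝ) + 1) ^ δ)))
        + ((x n ω - drift δ γ (fun k => x k ω) n) / ((n : ℝ) + 1) ^ δ) ^ 2 := by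
      intro ω
      rw [← add_assoc m j 1, ← hn, noiseSum_succ]; ring
    simp only [hexp]
    rw [integral_add (((hM'.pow 2).add ((hM'.mul hd).const_mul 2)).integrable (ℱ.le _))
      ((hd.pow 2).integrable (ℱ.le _)),
      integral_add ((hM'.pow 2).integrable (ℱ.le _)) (((hM'.mul hd).const_mul 2).integrable (ℱ.le _)),
      integral_const_mul, hcross, mul_zero, add_zero]

end IsDriftSequence

theorem eLpNorm_two_le_of_integral_sq_le {P : Measure Ω} {f : Ω → ℝ} (hf : MemLp f 2 P) {c : ℝ}
    (hc : ∫ ω, f ω ^ 2 ∂P ≤ c) : eLpNorm f 2 P ≤ ENNReal.ofReal (√c) := by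
  rw [hf.eLpNorm_eq_integral_rpow_norm (by simp) (by simp), Real.sqrt_eq_rpow]
  simp only [ENNReal.toReal_ofNat, Real.rpow_ofNat, Real.norm_eq_abs, sq_abs, one_div]
  gcongr

theorem tendsto_integral_sq_of_tendsto_eLpNorm {P : Measure Ω} {f : ℕ → Ω → ℝ} {g : Ω → ℝ}
    (hf : ∀ n, MemLp (f n) 2 P) (hg : MemLp g 2 P)
    (h : Tendsto (fun n => eLpNorm (f n - g) 2 P) atTop (𝓝 0)) :
    Tendsto (fun n => ∫ ω, f n ω ^ 2 ∂P) atTop (𝓝 (∫ ω, g ω ^ 2 ∂P)) := by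
  have h1 : Tendsto (fun n => (hf n).toLp (f n)) atTop (𝓝 (hg.toLp g)) :=
    (Lp.tendsto_Lp_iff_tendsto_eLpNorm'' f hf g hg).2 h
  have key : ∀ {u : Ω → ℝ} (hu : MemLp u 2 P), ‖hu.toLp u‖ ^ 2 = ∫ ω, u ω ^ 2 ∂P := by
    intro u hu
    rw [Lp.norm_toLp, hu.eLpNorm_eq_integral_rpow_norm (by simp) (by simp)]
    simp only [ENNReal.toReal_ofNat, Real.rpow_ofNat, Real.norm_eq_abs, sq_abs]
    have h0 : 0 ≤ ∫ ω, u ω ^ 2 ∂P := integral_nonneg fun ω => sq_nonneg _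
    rw [ENNReal.toReal_ofReal (by positivity), ← Real.rpow_natCast, ← Real.rpow_mul h0]
    simp
  have h2 := (h1.norm).pow 2
  simpa only [key] using h2

theorem tendsto_integral_of_tendsto_eLpNorm_two {P : Measure Ω} [IsProbabilityMeasure P]
    {f : ℕ → Ω → ℝ} {g : Ω → ℝ} (hf : ∀ n, MemLp (f n) 2 P) (hg : MemLp g 2 P)
    (h : Tendsto (fun n => eLpNorm (f n - g) 2 P) atTop (𝓝 0)) :
    Tendsto (fun n => ∫ ω, f n ω ∂P) atTop (𝓝 (∫ ω, g ω ∂P)) := by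
  refine tendsto_integral_of_L1' g (hg.integrable (by norm_num)).aestronglyMeasurable
    (Eventually.of_forall fun n => (hf n).integrable (by norm_num)) ?_
  exact tendsto_of_tendsto_of_tendsto_of_le_of_le tendsto_const_nhds h (fun _ => bot_le) fun n =>
    eLpNorm_le_eLpNorm_of_exponent_le (by norm_num) ((hf n).sub hg).aestronglyMeasurable

namespace IsDriftSequence

variable {δ γ K σ2 : ℝ} {P : Measure Ω} [IsProbabilityMeasure P] {ℱ : Filtration ℕ mΩ}
  {x : ℕ → Ω → ℝ}

/-- Since `2δ > 1`, the increment bounds are summable. The martingale is thus bounded in `L²`, hence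
in `L¹`, and converges almost surely; Fatou's lemma along the tails upgrades this to `L²`. -/
theorem exists_noise_limit (h : IsDriftSequence δ γ K σ2 P ℱ x) (hδ : 1 / 2 < δ) (hδ1 : δ ≤ 1)
    (hγ : |γ| ≤ 1) : ∃ L : Ω → ℝ, Measurable L ∧ MemLp L 2 P ∧
      (∀ᵐ ω ∂P, Tendsto (fun n => noiseSum δ γ (fun k => x k ω) n) atTop (𝓝 (L ω))) ∧
      Tendsto (fun n => eLpNorm (fun ω => noiseSum δ γ (fun k => x k ω) n - L ω) 2 P)
        atTop (𝓝 0) := by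
  set D : ℕ → ℝ := fun i => (3 * K) ^ 2 * (1 / |(i : ℝ) + 1| ^ (2 * δ)) with hD
  have hDs : Summable D :=
    ((Real.summable_one_div_nat_add_rpow 1 (2 * δ)).2 (by linarith)).mul_left _
  have hD0 : ∀ i, 0 ≤ D i := fun i => by positivity
  set M : ℕ → Ω → ℝ := fun n ω => noiseSum δ γ (fun k => x k ω) n with hM
  have hMb : ∀ n, IsBddMeas mΩ (M n) := fun n => (h.isBddMeas_noiseSum n).mono (ℱ.le n)
  have hcauchy : ∀ m j, eLpNorm (fun ω => M (m + j) ω - M m ω) 2 P ≤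
      ENNReal.ofReal (√(∑' i, D (i + m))) := by
    intro m j
    refine eLpNorm_two_le_of_integral_sq_le (((hMb _).sub (hMb _)).memLp le_rfl 2) ?_
    exact (h.integral_noiseSum_sub_sq_le (by linarith) hδ1 hγ m j).trans
      (((summable_nat_add_iff m).2 hDs).sum_le_tsum _ fun i _ => hD0 _)
  have hbdd : ∀ n, eLpNorm (M n) 2 P ≤ ((√(∑' i, D i)).toNNReal : ENNReal) := by
    intro n
    simpa [hM, noiseSum, ENNReal.ofReal] using hcauchy 0 n
  have hsub : Submartingale M ℱ P := h.martingale_noiseSum.submartingale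
  have hbdd1 : ∀ n, eLpNorm (M n) 1 P ≤ ((√(∑' i, D i)).toNNReal : ENNReal) := fun n =>
    (eLpNorm_le_eLpNorm_of_exponent_le (by norm_num)
      (hMb n).1.aestronglyMeasurable).trans (hbdd n)
  obtain ⟨N, hNm, hlim⟩ := measurable_limit_of_tendsto_metrizable_ae
    (fun n => (hMb n).1.aemeasurable) (hsub.exists_ae_tendsto_of_bdd hbdd1)
  refine ⟨N, hNm, ⟨hNm.aestronglyMeasurable, ?_⟩, hlim, ?_⟩
  · calc eLpNorm N 2 P ≤ liminf (fun n => eLpNorm (M n) 2 P) atTop :=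
          Lp.eLpNorm_lim_le_liminf_eLpNorm (fun n => (hMb n).1.aestronglyMeasurable) N hlim
      _ ≤ liminf (fun _ : ℕ => ((√(∑' i, D i)).toNNReal : ENNReal)) atTop :=
          liminf_le_liminf (Eventually.of_forall hbdd)
      _ = ((√(∑' i, D i)).toNNReal : ENNReal) := liminf_const _
      _ < ⊤ := ENNReal.coe_lt_top
  have htail : Tendsto (fun m => ENNReal.ofReal (√(∑' i, D (i + m)))) atTop (𝓝 0) := by
    have h1 := (Real.continuous_sqrt.tendsto 0).comp (tendsto_sum_nat_add D)
    rw [Real.sqrt_zero] at h1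
    simpa using ENNReal.tendsto_ofReal h1
  refine tendsto_of_tendsto_of_tendsto_of_le_of_le tendsto_const_nhds htail (fun _ => bot_le)
    fun m => ?_
  have hfatou := Lp.eLpNorm_lim_le_liminf_eLpNorm (p := 2) (μ := P)
    (f := fun j ω => M (m + j) ω - M m ω)
    (fun j => ((hMb _).sub (hMb _)).1.aestronglyMeasurable)
    (fun ω => N ω - M m ω) (by
      filter_upwards [hlim] with ω hω
      refine Tendsto.sub_const ?_ _
      simpa only [add_comm m] using (tendsto_add_atTop_iff_nat m).2 hω)
  calc eLpNorm (fun ω => M m ω - N ω) 2 P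
      = eLpNorm (fun ω => N ω - M m ω) 2 P := eLpNorm_sub_comm _ _ _ _
    _ ≤ liminf (fun j => eLpNorm (fun ω => M (m + j) ω - M m ω) 2 P) atTop := hfatou
    _ ≤ liminf (fun _ : ℕ => ENNReal.ofReal (√(∑' i, D (i + m)))) atTop :=
        liminf_le_liminf (Eventually.of_forall fun j => hcauchy m j)
    _ = _ := liminf_const _

/-- The normalised partial sums converge almost surely and in `L²`. -/
theorem exists_limit (h : IsDriftSequence δ γ K σ2 P ℱ x) (hδ : 1 / 2 < δ) (hδ1 : δ ≤ 1)
    (hγ : |γ| ≤ 1 / 2) : ∃ L : Ω → ℝ, Measurable L ∧ MemLp L 2 P ∧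
      (∀ᵐ ω ∂P, Tendsto (fun n : ℕ => partialSum (fun k => x k ω) n / (n : ℝ) ^ δ)
        atTop (𝓝 (L ω))) ∧
      Tendsto (fun n : ℕ => eLpNorm
        ((fun ω => partialSum (fun k => x k ω) n / (n : ℝ) ^ δ) - L) 2 P) atTop (𝓝 0) := by
  obtain ⟨N, hNm, hN2, hNae, hNL⟩ := h.exists_noise_limit hδ hδ1 (by linarith)
  obtain ⟨r, hr, hrate⟩ := exists_rate_partialSum_sub_noiseSum (by linarith) hδ1 hγ K
  -- The part outside the martingale converges on every path to `l`. Its rate `r` does not depend on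
  -- `ω`, so the same bound serves for convergence in `L²`; `l` is measurable as a pointwise limit
  -- of the `R n`.
  choose l hl using fun ω => hrate (fun k => x k ω) (fun k => h.bound k ω)
  set R : ℕ → Ω → ℝ := fun n ω => partialSum (fun k => x k ω) (n + 1) / ((n : ℝ) + 1) ^ δ
    - noiseSum δ γ (fun k => x k ω) (n + 1) with hR
  have hRb : ∀ n, IsBddMeas mΩ (R n) := fun n =>
    (((h.isBddMeas_partialSum _).div_const _).sub (h.isBddMeas_noiseSum _)).mono (ℱ.le (n + 1))
  have hRl : ∀ ω, Tendsto (fun n => R n ω) atTop (𝓝 (l ω)) := fun ω =>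
    tendsto_iff_norm_sub_tendsto_zero.2 (squeeze_zero (fun _ => norm_nonneg _) (hl ω) hr)
  have hlm : Measurable l :=
    measurable_of_tendsto_metrizable (fun n => (hRb n).1) (tendsto_pi_nhds.2 hRl)
  have hlb : IsBddMeas mΩ l := by
    obtain ⟨B, hB⟩ := (hRb 0).2
    refine ⟨hlm, B + r 0, fun ω => ?_⟩
    have h1 := abs_le.1 (hB ω)
    have h2 := abs_le.1 (hl ω 0)
    simp only [hR] at h1
    rw [abs_le]; constructor <;> linarith
  have hsplit : ∀ n ω, partialSum (fun k => x k ω) (n + 1) / ((n : ℝ) + 1) ^ δ =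
      noiseSum δ γ (fun k => x k ω) (n + 1) + R n ω := fun n ω => by simp only [hR]; ring
  refine ⟨fun ω => N ω + l ω, hNm.add hlm, hN2.add (hlb.memLp le_rfl 2), ?_, ?_⟩
  · filter_upwards [hNae] with ω hω
    rw [← tendsto_add_atTop_iff_nat 1]
    push_cast
    simp only [hsplit]
    exact ((tendsto_add_atTop_iff_nat 1).2 hω).add (hRl ω)
  · rw [← tendsto_add_atTop_iff_nat 1]
    have hb : Tendsto (fun n => eLpNorm
        (fun ω => noiseSum δ γ (fun k => x k ω) (n + 1) - N ω) 2 P + ENNReal.ofReal (r n))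
        atTop (𝓝 0) := by
      simpa using ((tendsto_add_atTop_iff_nat 1).2 hNL).add (ENNReal.tendsto_ofReal hr)
    refine tendsto_of_tendsto_of_tendsto_of_le_of_le tendsto_const_nhds hb (fun _ => bot_le)
      fun n => ?_
    have he : ((fun ω => partialSum (fun k => x k ω) (n + 1) / (((n + 1 : ℕ) : ℝ)) ^ δ)
        - fun ω => N ω + l ω) =
        (fun ω => noiseSum δ γ (fun k => x k ω) (n + 1) - N ω) + fun ω => R n ω - l ω := by
      ext ω
      simp only [Pi.sub_apply, Pi.add_apply]
      push_cast
      rw [hsplit]; ring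
    simp only [he]
    refine (eLpNorm_add_le (((h.isBddMeas_noiseSum _).mono (ℱ.le _)).1.sub
      hNm).aestronglyMeasurable ((hRb n).sub hlb).1.aestronglyMeasurable (by norm_num)).trans ?_
    refine add_le_add le_rfl ?_
    refine (eLpNorm_le_of_ae_bound (ae_of_all _ fun ω => hl ω n)).trans ?_
    simp

end IsDriftSequence

end

/-! ### Parity and averages over the step sets -/

variable {d : ℕ}

namespace StepSets

variable (V : StepSets d)

theorem mem_even_iff (v : EuclideanSpace ℝ (Fin d)) : v ∈ V.even ↔ -v ∈ V.odd := by
  rw [V.mem_odd_iff, neg_neg]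

theorem at_mem_all {k : ℕ} {v : EuclideanSpace ℝ (Fin d)} (hv : v ∈ V.at_ k) : v ∈ V.all := by
  unfold at_ at hv
  split_ifs at hv with h
  · exact Or.inl hv
  · exact Or.inr hv

theorem mem_all_iff (k : ℕ) (v : EuclideanSpace ℝ (Fin d)) :
    v ∈ V.all ↔ v ∈ V.at_ k ∨ v ∈ V.at_ (k + 1) := by
  unfold at_ all
  by_cases h : Odd k
  · simp [h, Nat.odd_add_one]
  · simp [h, Nat.odd_add_one, or_comm]

theorem neg_mem_at_succ_iff (k : ℕ) (v : EuclideanSpace ℝ (Fin d)) :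
    -v ∈ V.at_ (k + 1) ↔ v ∈ V.at_ k := by
  unfold at_
  by_cases h : Odd k
  · simp [h, Nat.odd_add_one, V.mem_odd_iff]
  · simp [h, Nat.odd_add_one, V.mem_even_iff]

theorem at_eq_of_even {k n : ℕ} (h : Even (n + k)) : V.at_ k = V.at_ n := by
  unfold at_
  have : Odd k ↔ Odd n := by
    rw [← Nat.not_even_iff_odd, ← Nat.not_even_iff_odd, (Nat.even_add.1 h)]
  simp [this]

theorem disjoint_at_succ (k : ℕ) : Disjoint (V.at_ k) (V.at_ (k + 1)) := by
  unfold at_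
  by_cases h : Odd k
  · simpa [h, Nat.odd_add_one] using V.disjoint
  · simpa [h, Nat.odd_add_one] using V.disjoint.symm

theorem sum_at_succ (k : ℕ) (φ : EuclideanSpace ℝ (Fin d) → ℝ) :
    ∑ w ∈ V.at_ (k + 1), φ w = ∑ w ∈ V.at_ k, φ (-w) := by
  refine (Finset.sum_bij (fun w _ => -w) (fun w hw => (V.neg_mem_at_succ_iff k w).2 hw)
    (fun _ _ _ _ h => neg_injective h) (fun w hw => ⟨-w, ?_, neg_neg w⟩) (fun _ _ => rfl)).symm
  rwa [← V.neg_mem_at_succ_iff, neg_neg]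

theorem two_le_m : (2 : ℝ) ≤ V.m := by exact_mod_cast V.two_le_card

/-- All steps, as a finite set. -/
noncomputable def allFinset : Finset (EuclideanSpace ℝ (Fin d)) :=
  open Classical in V.odd ∪ V.even

theorem mem_allFinset (v : EuclideanSpace ℝ (Fin d)) : v ∈ V.allFinset ↔ v ∈ V.all := by
  simp [allFinset, all]

/-- The average of a function over the steps that are admissible at time `k`. -/
noncomputable def mean (φ : EuclideanSpace ℝ (Fin d) → ℝ) (k : ℕ) : ℝ :=
  (∑ w ∈ V.at_ k, φ w) / V.m

/-- The sign `s` lets one argument cover coordinates (`s = -1`) and squared coordinates (`s = 1`).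
-/
theorem mean_succ {φ : EuclideanSpace ℝ (Fin d) → ℝ} {s : ℝ} (hs : ∀ v, φ (-v) = s * φ v) (k : ℕ) :
    V.mean φ (k + 1) = s * V.mean φ k := by
  rw [mean, mean, sum_at_succ, Finset.sum_congr rfl fun w _ => hs w, ← Finset.mul_sum, mul_div_assoc]

theorem mean_of_even {k n : ℕ} (h : Even (n + k)) (φ : EuclideanSpace ℝ (Fin d) → ℝ) :
    V.mean φ k = V.mean φ n := by
  rw [mean, mean, V.at_eq_of_even h]

theorem mean_of_odd {k n : ℕ} (h : ¬ Even (n + k)) {φ : EuclideanSpace ℝ (Fin d) → ℝ} {s : ℝ}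
    (hs : ∀ v, φ (-v) = s * φ v) : V.mean φ n = s * V.mean φ k := by
  have : Even (n + (k + 1)) := by rw [← add_assoc]; exact Nat.even_add_one.2 h
  rw [← V.mean_succ hs, V.mean_of_even this]

end StepSets

/-! ### The filtration of the walk and the conditional law of a step -/

open Classical in
theorem measurable_sum_ite {Ω : Type*} {m : MeasurableSpace Ω} {U : Ω → ℕ}
    (hU : Measurable U) {X : ℕ → Ω → EuclideanSpace ℝ (Fin d)}
    {G : EuclideanSpace ℝ (Fin d) → Ω → EuclideanSpace ℝ (Fin d)} {s : Finset ℕ}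
    {t : Finset (EuclideanSpace ℝ (Fin d))}
    (hX : ∀ k ∈ s, Measurable (X k)) (hG : ∀ v ∈ t, Measurable (G v)) :
    Measurable fun ω => ∑ k ∈ s, ∑ v ∈ t, if U ω = k ∧ X k ω = v then G v ω else 0 := by
  refine Finset.measurable_fun_sum _ fun k hk => Finset.measurable_fun_sum _ fun v hv => ?_
  exact Measurable.ite ((hU (measurableSet_singleton k)).inter
    (hX k hk (measurableSet_singleton v))) (hG v hv) measurable_const

theorem innovation_succ {V : StepSets d} {Ω : Type*} (X : ℕ → Ω → EuclideanSpace ℝ (Fin d))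
    (U : ℕ → Ω → ℕ) (G : ℕ → EuclideanSpace ℝ (Fin d) → Ω → EuclideanSpace ℝ (Fin d)) (n : ℕ) :
    innovation V X U G (n + 1) = MeasurableSpace.comap (U (n + 1)) inferInstance ⊔
      ⨆ v ∈ V.all, MeasurableSpace.comap (G (n + 2) v) inferInstance := rfl

namespace Walk

variable {V : StepSets d} {p q : ℝ} {Ω : Type*} [mΩ : MeasurableSpace Ω] {P : Measure Ω}
  (W : Walk V p q P)

theorem innovation_le (n : ℕ) : innovation V W.X W.U W.G n ≤ mΩ := by
  cases n with
  | zero => exact W.measurable_first.comap_le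
  | succ n =>
    rw [innovation_succ]
    exact sup_le (W.measurable_U _ (by omega)).comap_le
      (iSup₂_le fun v hv => (W.measurable_G _ (by omega) v hv).comap_le)

/-- The natural filtration: at time `n`, the first `n` innovations are known. -/
def past : Filtration ℕ mΩ where
  seq n := ⨆ j ∈ Set.Iio n, innovation V W.X W.U W.G j
  mono' _ _ h := iSup₂_mono' fun j hj => ⟨j, lt_of_lt_of_le hj h, le_rfl⟩
  le' _ := iSup₂_le fun j _ => W.innovation_le j

theorem innovation_le_past {j n : ℕ} (h : j < n) : innovation V W.X W.U W.G j ≤ W.past n :=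
  le_iSup₂_of_le (f := fun j (_ : j ∈ Set.Iio n) => innovation V W.X W.U W.G j) j h le_rfl

theorem indep_past (n : ℕ) : Indep (W.past n) (innovation V W.X W.U W.G n) P := by
  have := indep_iSup_of_disjoint W.innovation_le W.indep (S := Set.Iio n) (T := {n})
    (by simp)
  simpa [past] using this

theorem measurable_U_innovation {n : ℕ} (hn : 1 ≤ n) :
    Measurable[innovation V W.X W.U W.G n] (W.U n) := by
  obtain ⟨n, rfl⟩ := Nat.exists_eq_add_of_le' hn
  rw [innovation_succ]
  exact (comap_measurable _).mono le_sup_left le_rfl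

theorem measurable_G_innovation {n : ℕ} (hn : 1 ≤ n) {v : EuclideanSpace ℝ (Fin d)}
    (hv : v ∈ V.all) : Measurable[innovation V W.X W.U W.G n] (W.G (n + 1) v) := by
  obtain ⟨n, rfl⟩ := Nat.exists_eq_add_of_le' hn
  rw [innovation_succ]
  exact (comap_measurable _).mono ((le_iSup₂ (f := fun v (_ : v ∈ V.all) =>
    MeasurableSpace.comap (W.G (n + 2) v) inferInstance) v hv).trans le_sup_right) le_rfl

theorem X_mem {k : ℕ} (hk : 1 ≤ k) (ω : Ω) : W.X k ω ∈ V.at_ k := by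
  induction k using Nat.strong_induction_on with
  | _ k ih =>
    rcases Nat.eq_or_lt_of_le hk with rfl | hk'
    · simpa [StepSets.at_] using W.first_mem ω
    · obtain ⟨n, rfl⟩ := Nat.exists_eq_add_of_le' hk
      rw [W.X_succ n (by omega)]
      have hU := Finset.mem_Icc.1 (W.U_mem n (by omega) ω)
      exact W.G_mem _ (by omega) _ (V.at_mem_all (ih _ (by omega) hU.1)) ω

-- Splitting over the values of the remembered time and step replaces the composition `G (X (U))` by
-- a finite sum. Measurability is then immediate, and each term is a product to which independence
-- applies.
open Classical in
theorem map_X_succ {F : Type*} [AddCommMonoid F] (φ : EuclideanSpace ℝ (Fin d) → F) {n : ℕ}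
    (hn : 1 ≤ n) (ω : Ω) : φ (W.X (n + 1) ω) = ∑ k ∈ Finset.Icc 1 n, ∑ v ∈ V.allFinset,
      if W.U n ω = k ∧ W.X k ω = v then φ (W.G (n + 1) v ω) else 0 := by
  have hU := W.U_mem n hn ω
  rw [Finset.sum_eq_single_of_mem _ hU, Finset.sum_eq_single_of_mem (W.X (W.U n ω) ω)]
  · simp [W.X_succ n hn ω]
  · rw [V.mem_allFinset]
    exact V.at_mem_all (W.X_mem (Finset.mem_Icc.1 hU).1 ω)
  · intro v _ hv
    rw [if_neg (fun h => hv h.2.symm)]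
  · intro k _ hk
    exact Finset.sum_eq_zero fun v _ => if_neg fun h => hk h.1.symm

/-- Innovation number `j` produces step `j + 1`, so the first `k` innovations, numbered from `0`,
determine step `k`. -/
theorem measurable_X_past {k : ℕ} (hk : 1 ≤ k) {n : ℕ} (hn : k ≤ n) :
    Measurable[W.past n] (W.X k) := by
  induction k using Nat.strong_induction_on generalizing n with
  | _ k ih =>
    refine Measurable.mono ?_ (W.past.mono hn) le_rfl
    rcases Nat.eq_or_lt_of_le hk with rfl | hk'
    · exact (comap_measurable (W.X 1)).mono (W.innovation_le_past (j := 0) (by omega)) le_rfl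
    · obtain ⟨n, rfl⟩ := Nat.exists_eq_add_of_le' hk
      have hn1 : 1 ≤ n := by omega
      classical
      have he : W.X (n + 1) = fun ω => ∑ k ∈ Finset.Icc 1 n, ∑ v ∈ V.allFinset,
          if W.U n ω = k ∧ W.X k ω = v then W.G (n + 1) v ω else 0 :=
        funext fun ω => W.map_X_succ id hn1 ω
      rw [he]
      refine measurable_sum_ite (m := W.past (n + 1)) (U := W.U n) (X := W.X) (G := W.G (n + 1))
        ((W.measurable_U_innovation hn1).mono (W.innovation_le_past n.lt_succ_self) le_rfl) (fun j hj => ?_) (fun v hv => ?_)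
      · have hj' := Finset.mem_Icc.1 hj
        exact ih j (by omega) hj'.1 (by omega)
      · exact (W.measurable_G_innovation hn1 ((V.mem_allFinset v).1 hv)).mono
          (W.innovation_le_past n.lt_succ_self) le_rfl

theorem measurable_X {k : ℕ} (hk : 1 ≤ k) : Measurable (W.X k) :=
  (W.measurable_X_past hk le_rfl).mono (W.past.le k) le_rfl

/-! ### The conditional law of a step -/

theorem integral_of_law [IsProbabilityMeasure P] {Y : Ω → EuclideanSpace ℝ (Fin d)}
    (hY : Measurable Y) {s : Finset (EuclideanSpace ℝ (Fin d))} (hs : ∀ ω, Y ω ∈ s)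
    (φ : EuclideanSpace ℝ (Fin d) → ℝ) :
    ∫ ω, φ (Y ω) ∂P = ∑ w ∈ s, P.real {ω | Y ω = w} * φ w := by
  have h : ∀ ω, φ (Y ω) = ∑ w ∈ s, (Y ⁻¹' {w}).indicator (fun _ => φ w) ω := by
    intro ω
    rw [Finset.sum_eq_single_of_mem (Y ω) (hs ω)]
    · simp
    · intro w _ hw
      exact Set.indicator_of_notMem (fun h => hw h.symm) _
  simp only [h]
  rw [integral_finsetSum]
  · refine Finset.sum_congr rfl fun w _ => ?_
    rw [integral_indicator_const _ (hY (measurableSet_singleton w))]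
    rfl
  · exact fun w _ => (integrable_const _).indicator (hY (measurableSet_singleton w))

/-- This is the origin of `α` and `β`: mass `r` at `u` and equal mass elsewhere is an affine
combination of the point mass at `u`, with weight `(m r - 1) / (m - 1)`, and the uniform law. -/
theorem sum_law (k : ℕ) (φ : EuclideanSpace ℝ (Fin d) → ℝ) {r : ℝ}
    {u : EuclideanSpace ℝ (Fin d)} (hu : u ∈ V.at_ k) {f : EuclideanSpace ℝ (Fin d) → ℝ}
    (h1 : f u = r) (h2 : ∀ w ∈ V.at_ k, w ≠ u → f w = (1 - r) / ((V.m : ℝ) - 1)) :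
    ∑ w ∈ V.at_ k, f w * φ w = ((V.m : ℝ) * r - 1) / ((V.m : ℝ) - 1) * φ u
      + (1 - ((V.m : ℝ) * r - 1) / ((V.m : ℝ) - 1)) * V.mean φ k := by
  classical
  have hm := V.two_le_m
  have hm1 : (V.m : ℝ) - 1 ≠ 0 := by linarith
  have hm0 : (V.m : ℝ) ≠ 0 := by linarith
  rw [StepSets.mean, ← Finset.add_sum_erase _ _ hu, ← Finset.add_sum_erase _ φ hu, h1,
    Finset.sum_congr rfl fun w hw => by
      rw [h2 w (Finset.mem_of_mem_erase hw) (Finset.ne_of_mem_erase hw)],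
    ← Finset.mul_sum]
  field_simp
  ring

open Classical in
theorem integral_G [IsProbabilityMeasure P] {φ : EuclideanSpace ℝ (Fin d) → ℝ} {s : ℝ}
    (hs : ∀ v, φ (-v) = s * φ v) {k : ℕ} (hk : 2 ≤ k) {v : EuclideanSpace ℝ (Fin d)}
    (hv : v ∈ V.all) : ∫ ω, φ (W.G k v ω) ∂P = if v ∈ V.at_ k
      then V.alpha p * φ v + (1 - V.alpha p) * V.mean φ k
      else s * V.beta q * φ v + (1 - V.beta q) * V.mean φ k := by
  rw [integral_of_law (W.measurable_G k hk v hv) (W.G_mem k hk v hv)]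
  split_ifs with h
  · exact sum_law k φ h ((W.law_G_same k hk v h v h).1 rfl)
      fun w hw => (W.law_G_same k hk v h w hw).2
  · have h' : v ∈ V.at_ (k + 1) := ((V.mem_all_iff k v).1 hv).resolve_left h
    have hn : -v ∈ V.at_ k := by rwa [← V.neg_mem_at_succ_iff, neg_neg]
    rw [sum_law k φ hn ((W.law_G_opposite k hk v h' _ hn).1 rfl)
      fun w hw => (W.law_G_opposite k hk v h' w hw).2, hs, StepSets.beta]
    ring

theorem isBddMeas_X {φ : EuclideanSpace ℝ (Fin d) → ℝ} (hφ : Measurable φ) {k n : ℕ} (hk : 1 ≤ k)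
    (hn : k ≤ n) : IsBddMeas (W.past n) (fun ω => φ (W.X k ω)) := by
  refine ⟨hφ.comp (W.measurable_X_past hk hn), ∑ w ∈ V.at_ k, |φ w|, fun ω => ?_⟩
  exact Finset.single_le_sum (f := fun w => |φ w|) (fun w _ => abs_nonneg _) (W.X_mem hk ω)

-- Independence is used twice. The factor `f` and the event `X k = v` belong to the past, hence are
-- independent of the new innovation; within the innovation, `U n` is independent of `G (n + 1) v`
-- for each fixed `v`, which suffices because `v` is frozen in each term.
open Classical in
theorem integral_mul_X_succ [IsProbabilityMeasure P] {φ : EuclideanSpace ℝ (Fin d) → ℝ}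
    (hφ : Measurable φ) {n : ℕ} (hn : 1 ≤ n) {f : Ω → ℝ} (hf : IsBddMeas (W.past n) f) :
    ∫ ω, f ω * φ (W.X (n + 1) ω) ∂P = (∑ k ∈ Finset.Icc 1 n, ∫ ω, f ω *
      (∑ v ∈ V.allFinset, if W.X k ω = v then ∫ ω', φ (W.G (n + 1) v ω') ∂P else 0) ∂P) / n := by
  have hfm : IsBddMeas mΩ f := hf.mono (W.past.le n)
  have hX : ∀ k ∈ Finset.Icc 1 n, ∀ v, IsBddMeas (W.past n)
      (fun ω => if W.X k ω = v then (1 : ℝ) else 0) := by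
    intro k hk v
    have hk' := Finset.mem_Icc.1 hk
    refine ⟨?_, 1, fun ω => by dsimp only; split_ifs <;> simp⟩
    exact Measurable.ite (W.measurable_X_past hk'.1 hk'.2 (measurableSet_singleton v))
      measurable_const measurable_const
  have hU : ∀ k, IsBddMeas (innovation V W.X W.U W.G n)
      (fun ω => if W.U n ω = k then (1 : ℝ) else 0) := by
    intro k
    refine ⟨?_, 1, fun ω => by dsimp only; split_ifs <;> simp⟩
    exact Measurable.ite (W.measurable_U_innovation hn (measurableSet_singleton k))
      measurable_const measurable_const
  have hG : ∀ v ∈ V.allFinset, IsBddMeas (innovation V W.X W.U W.G n)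
      (fun ω => φ (W.G (n + 1) v ω)) := by
    intro v hv
    have hv' := (V.mem_allFinset v).1 hv
    refine ⟨hφ.comp (W.measurable_G_innovation hn hv'), ∑ w ∈ V.at_ (n + 1), |φ w|, fun ω => ?_⟩
    exact Finset.single_le_sum (f := fun w => |φ w|) (fun w _ => abs_nonneg _)
      (W.G_mem (n + 1) (by omega) v hv' ω)
  have hle := W.innovation_le n
  have hterm : ∀ k ∈ Finset.Icc 1 n, ∀ v ∈ V.allFinset,
      ∫ ω, (f ω * (if W.X k ω = v then (1 : ℝ) else 0)) *
        ((if W.U n ω = k then (1 : ℝ) else 0) * φ (W.G (n + 1) v ω)) ∂P =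
      (∫ ω, f ω * (if W.X k ω = v then (1 : ℝ) else 0) ∂P) *
        (1 / n * ∫ ω, φ (W.G (n + 1) v ω) ∂P) := by
    intro k hk v hv
    have hv' := (V.mem_allFinset v).1 hv
    have b1 := hf.mul (hX k hk v)
    have b2 := (hU k).mul (hG v hv)
    have i1 : IndepFun (fun ω => f ω * (if W.X k ω = v then (1 : ℝ) else 0))
        (fun ω => (if W.U n ω = k then (1 : ℝ) else 0) * φ (W.G (n + 1) v ω)) P :=
      (IndepFun_iff_Indep _ _ _).2 (indep_of_indep_of_le_left
        (indep_of_indep_of_le_right (W.indep_past n) b2.1.comap_le) b1.1.comap_le)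
    have i2 : IndepFun (fun ω => if W.U n ω = k then (1 : ℝ) else 0)
        (fun ω => φ (W.G (n + 1) v ω)) P :=
      (W.indep_U_G n hn v hv').comp (φ := fun j : ℕ => if j = k then (1 : ℝ) else 0) (ψ := φ)
        (measurable_of_countable _) hφ
    rw [i1.integral_fun_mul_eq_mul_integral (b1.mono (W.past.le n)).1.aestronglyMeasurable
      (b2.mono hle).1.aestronglyMeasurable,
      i2.integral_fun_mul_eq_mul_integral ((hU k).mono hle).1.aestronglyMeasurable
      ((hG v hv).mono hle).1.aestronglyMeasurable]
    have hlaw : ∫ ω, (if W.U n ω = k then (1 : ℝ) else 0) ∂P = 1 / n := by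
      rw [← W.law_U n hn k hk]
      have : (fun ω => if W.U n ω = k then (1 : ℝ) else 0) = {ω | W.U n ω = k}.indicator 1 := by
        ext ω; simp [Set.indicator_apply]
      rw [this]
      exact integral_indicator_one (W.measurable_U n hn (measurableSet_singleton k))
    rw [hlaw]
  have hint : ∀ k ∈ Finset.Icc 1 n, ∀ v ∈ V.allFinset, Integrable
      (fun ω => (f ω * (if W.X k ω = v then (1 : ℝ) else 0)) *
        ((if W.U n ω = k then (1 : ℝ) else 0) * φ (W.G (n + 1) v ω))) P := fun k hk v hv =>
    ((hfm.mul ((hX k hk v).mono (W.past.le n))).mul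
      (((hU k).mul (hG v hv)).mono hle)).integrable le_rfl
  have hexp : ∀ ω, f ω * φ (W.X (n + 1) ω) = ∑ k ∈ Finset.Icc 1 n, ∑ v ∈ V.allFinset,
      (f ω * (if W.X k ω = v then (1 : ℝ) else 0)) *
        ((if W.U n ω = k then (1 : ℝ) else 0) * φ (W.G (n + 1) v ω)) := by
    intro ω
    rw [W.map_X_succ φ hn, Finset.mul_sum]
    refine Finset.sum_congr rfl fun k _ => ?_
    rw [Finset.mul_sum]
    refine Finset.sum_congr rfl fun v _ => ?_
    by_cases h1 : W.U n ω = k <;> by_cases h2 : W.X k ω = v <;> simp [h1, h2]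
  simp only [hexp]
  rw [integral_finsetSum _ fun k hk => integrable_finsetSum _ fun v hv => hint k hk v hv,
    Finset.sum_div]
  refine Finset.sum_congr rfl fun k hk => ?_
  rw [integral_finsetSum _ fun v hv => hint k hk v hv,
    Finset.sum_congr rfl fun v hv => hterm k hk v hv]
  have hexp2 : ∀ ω, f ω * (∑ v ∈ V.allFinset, if W.X k ω = v then ∫ ω', φ (W.G (n + 1) v ω') ∂P
      else 0) = ∑ v ∈ V.allFinset, f ω * (if W.X k ω = v then (1 : ℝ) else 0) *
        ∫ ω', φ (W.G (n + 1) v ω') ∂P := by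
    intro ω
    rw [Finset.mul_sum]
    refine Finset.sum_congr rfl fun v _ => ?_
    by_cases h2 : W.X k ω = v <;> simp [h2]
  simp only [hexp2]
  rw [integral_finsetSum _ fun v hv =>
    ((hfm.mul ((hX k hk v).mono (W.past.le n))).integrable le_rfl).mul_const _, Finset.sum_div]
  refine Finset.sum_congr rfl fun v _ => ?_
  rw [integral_mul_const]
  ring

/-- The conditional mean of a centred function of the next step. -/
theorem integral_mul_centred_succ [IsProbabilityMeasure P] {φ : EuclideanSpace ℝ (Fin d) → ℝ}
    (hφ : Measurable φ) {s : ℝ} (hs : ∀ v, φ (-v) = s * φ v) {n : ℕ} (hn : 1 ≤ n) {f : Ω → ℝ}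
    (hf : IsBddMeas (W.past n) f) :
    ∫ ω, f ω * (φ (W.X (n + 1) ω) - V.mean φ (n + 1)) ∂P = (∑ k ∈ Finset.Icc 1 n,
      (if Even (n + 1 + k) then V.alpha p else s * V.beta q) *
        ∫ ω, f ω * (φ (W.X k ω) - V.mean φ k) ∂P) / n := by
  classical
  have hn0 : (n : ℝ) ≠ 0 := by positivity
  have hfm : IsBddMeas mΩ f := hf.mono (W.past.le n)
  have hX : ∀ {k}, 1 ≤ k → IsBddMeas mΩ (fun ω => φ (W.X k ω)) := fun {k} hk =>
    (W.isBddMeas_X hφ hk le_rfl).mono (W.past.le k)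
  have key : ∀ k ∈ Finset.Icc 1 n, ∫ ω, f ω * (∑ v ∈ V.allFinset, if W.X k ω = v then
      ∫ ω', φ (W.G (n + 1) v ω') ∂P else 0) ∂P =
      (if Even (n + 1 + k) then V.alpha p else s * V.beta q) *
        ∫ ω, f ω * (φ (W.X k ω) - V.mean φ k) ∂P + V.mean φ (n + 1) * ∫ ω, f ω ∂P := by
    intro k hk
    have hk' := Finset.mem_Icc.1 hk
    rw [← integral_const_mul, ← integral_const_mul, ← integral_add
      (((hfm.mul ((hX hk'.1).sub (.const _))).const_mul _).integrable le_rfl)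
      ((hfm.const_mul _).integrable le_rfl)]
    congr 1; ext ω
    have hmem := W.X_mem hk'.1 ω
    have hall := V.at_mem_all hmem
    rw [Finset.sum_ite_eq, if_pos ((V.mem_allFinset _).2 hall),
      W.integral_G hs (by omega) hall]
    -- The mean reaction is affine in `φ (X k)` and sends `V.mean φ k` to `V.mean φ (n + 1)` in both
    -- cases, so centring leaves only the slope.
    by_cases h : Even (n + 1 + k)
    · rw [if_pos (by rwa [← V.at_eq_of_even h]), if_pos h, V.mean_of_even h]
      ring
    · have hne : W.X k ω ∉ V.at_ (n + 1) := by
        intro hmem'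
        have h2 : Even (n + 1 + 1 + k) := by
          rw [add_right_comm]; exact Nat.even_add_one.2 h
        rw [V.at_eq_of_even h2] at hmem
        exact Finset.disjoint_left.1 (V.disjoint_at_succ (n + 1)) hmem' hmem
      rw [if_neg hne, if_neg h, V.mean_of_odd h hs]
      ring
  have hexp : ∀ ω, f ω * (φ (W.X (n + 1) ω) - V.mean φ (n + 1)) =
      f ω * φ (W.X (n + 1) ω) - V.mean φ (n + 1) * f ω := fun ω => by ring
  simp only [hexp]
  rw [integral_sub ((hfm.mul (hX (by omega))).integrable le_rfl)
    ((hfm.const_mul _).integrable le_rfl), W.integral_mul_X_succ hφ hn hf,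
    Finset.sum_congr rfl key, Finset.sum_add_distrib, integral_const_mul]
  simp only [Finset.sum_const, Nat.card_Icc, nsmul_eq_mul]
  push_cast
  field_simp
  simp

/-- With `f = 1`, the centred expectations satisfy a homogeneous linear recursion, and the first one
vanishes because `X 1` is uniform. -/
theorem integral_X [IsProbabilityMeasure P] {φ : EuclideanSpace ℝ (Fin d) → ℝ}
    (hφ : Measurable φ) {s : ℝ} (hs : ∀ v, φ (-v) = s * φ v) {k : ℕ} (hk : 1 ≤ k) :
    ∫ ω, φ (W.X k ω) ∂P = V.mean φ k := by
  have hX : ∀ {k}, 1 ≤ k → Integrable (fun ω => φ (W.X k ω)) P := fun {k} hk =>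
    (W.isBddMeas_X hφ hk le_rfl).integrable (W.past.le k)
  suffices h : ∫ ω, (φ (W.X k ω) - V.mean φ k) ∂P = 0 by
    rw [integral_sub (hX hk) (integrable_const _)] at h
    simp at h; linarith
  induction k using Nat.strong_induction_on with
  | _ k ih =>
    rcases Nat.eq_or_lt_of_le hk with rfl | hk'
    · rw [integral_sub (hX le_rfl) (integrable_const _), integral_of_law W.measurable_first
        W.first_mem, Finset.sum_congr rfl fun w hw => by rw [W.law_first w hw], ← Finset.mul_sum]
      simp [StepSets.mean, StepSets.at_]
      ring
    · obtain ⟨n, rfl⟩ := Nat.exists_eq_add_of_le' hk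
      have := W.integral_mul_centred_succ hφ hs (n := n) (by omega) (.const 1)
      simp only [one_mul] at this
      rw [this, Finset.sum_eq_zero, zero_div]
      intro j hj
      have hj' := Finset.mem_Icc.1 hj
      rw [ih j (by omega) hj'.1, mul_zero]

end Walk

/-! ### Variance of a step and the parameter `γ` -/

namespace StepSets

variable (V : StepSets d)

/-- The variance of a function of a uniformly distributed odd step. -/
noncomputable def variance (φ : EuclideanSpace ℝ (Fin d) → ℝ) : ℝ :=
  V.mean (fun v => φ v ^ 2) 1 - V.mean φ 1 ^ 2

theorem variance_eq (φ : EuclideanSpace ℝ (Fin d) → ℝ) :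
    V.variance φ = (∑ w ∈ V.odd, (φ w - V.mean φ 1) ^ 2) / V.m := by
  have hm : (V.m : ℝ) ≠ 0 := by linarith [V.two_le_m]
  have h1 : V.at_ 1 = V.odd := by simp [at_]
  have h2 : ∑ w ∈ V.odd, φ w = V.m * V.mean φ 1 := by
    rw [mean, h1]; field_simp
  have h3 : ∀ w, (φ w - V.mean φ 1) ^ 2 = φ w ^ 2 - 2 * V.mean φ 1 * φ w + V.mean φ 1 ^ 2 :=
    fun w => by ring
  have h4 : (V.odd.card : ℝ) = V.m := rfl
  simp only [h3]
  rw [Finset.sum_add_distrib, Finset.sum_sub_distrib, ← Finset.mul_sum, h2, variance]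
  rw [mean, h1, Finset.sum_const, nsmul_eq_mul, h4]
  field_simp
  ring

theorem variance_nonneg (φ : EuclideanSpace ℝ (Fin d) → ℝ) : 0 ≤ V.variance φ := by
  rw [variance_eq]; positivity

/-- Two distinct odd steps differ in some coordinate, which is then not constant on `V.odd`. -/
theorem sum_variance_pos : 0 < ∑ i, V.variance (fun v => v i) := by
  obtain ⟨u, hu, v, hv, huv⟩ := Finset.one_lt_card.1 (lt_of_lt_of_le one_lt_two V.two_le_card)
  obtain ⟨i, hi⟩ : ∃ i, u i ≠ v i := by
    by_contra! h
    exact huv (PiLp.ext h)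
  refine Finset.sum_pos' (fun j _ => V.variance_nonneg _) ⟨i, Finset.mem_univ i, ?_⟩
  have hm : (0 : ℝ) < V.m := by linarith [V.two_le_m]
  rw [variance_eq]
  refine div_pos (Finset.sum_pos' (fun _ _ => sq_nonneg _) ?_) hm
  by_contra! h
  have h1 := pow_eq_zero_iff (two_ne_zero) |>.1 (le_antisymm (h u hu) (sq_nonneg _))
  have h2 := pow_eq_zero_iff (two_ne_zero) |>.1 (le_antisymm (h v hv) (sq_nonneg _))
  exact hi (by linarith)

theorem mean_succ_of_odd {φ : EuclideanSpace ℝ (Fin d) → ℝ} (hs : ∀ v, φ (-v) = -1 * φ v) (n : ℕ) :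
    V.mean φ (n + 1) = (-1) ^ n * V.mean φ 1 := by
  induction n with
  | zero => simp
  | succ n ih => rw [V.mean_succ hs, ih, pow_succ]; ring

theorem mean_succ_of_even {φ : EuclideanSpace ℝ (Fin d) → ℝ} (hs : ∀ v, φ (-v) = 1 * φ v) (n : ℕ) :
    V.mean φ (n + 1) = V.mean φ 1 := by
  induction n with
  | zero => simp
  | succ n ih => rw [V.mean_succ hs, ih, one_mul]

/-- Half the sum of `α` and `β`. -/
noncomputable def gamma (p q : ℝ) : ℝ := (V.alpha p + V.beta q) / 2

/-- Since `γ = α - δ = β + δ`, the bounds `α ≤ 1` and `β ≥ -1` together with `δ > 1/2` suffice. -/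
theorem abs_gamma_le {p q : ℝ} (hp : p ≤ 1) (hq : 0 ≤ q) (hδ : 1 / 2 < V.delta p q) :
    |V.gamma p q| ≤ 1 / 2 := by
  have hm := V.two_le_m
  have hα : V.alpha p ≤ 1 := by
    rw [alpha, div_le_one (by linarith)]
    nlinarith
  have hβ : -1 ≤ V.beta q := by
    rw [beta, le_div_iff₀ (by linarith)]
    nlinarith
  unfold delta at hδ
  rw [gamma, abs_le]
  constructor <;> linarith

end StepSets

/-! ### Coordinates of the walk, its variance and its limit -/

namespace Walk

variable {V : StepSets d} {p q : ℝ} {Ω : Type*} [mΩ : MeasurableSpace Ω] {P : Measure Ω}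
  (W : Walk V p q P)

/-- The `i`-th coordinates of the centred steps, numbered from `0`. -/
noncomputable def centred (i : Fin d) (n : ℕ) (ω : Ω) : ℝ :=
  W.X (n + 1) ω i - V.mean (fun v => v i) (n + 1)

theorem integral_centred [IsProbabilityMeasure P] (i : Fin d) (n : ℕ) :
    ∫ ω, W.centred i n ω ∂P = 0 := by
  have hφ : Measurable fun v : EuclideanSpace ℝ (Fin d) => v i := by fun_prop
  have hX := (W.isBddMeas_X hφ (k := n + 1) (by omega) le_rfl).integrable (P := P) (W.past.le _)
  have := W.integral_X hφ (s := -1) (fun v => by simp) (k := n + 1) (by omega)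
  simp only [centred]
  rw [integral_sub hX (integrable_const _), this]
  simp

/-- The slopes `α` and `-β` combine to `δ + γ (-1)^(n + k)`. The variance is constant in time
because the mean of a step changes only its sign and the mean of its square not at all. -/
theorem isDriftSequence [IsProbabilityMeasure P] (i : Fin d) :
    ∃ K, IsDriftSequence (V.delta p q) (V.gamma p q) K (V.variance fun v => v i) P W.past
      (W.centred i) := by
  have hφ : Measurable fun v : EuclideanSpace ℝ (Fin d) => v i := by fun_prop
  have hs : ∀ v : EuclideanSpace ℝ (Fin d), (-v) i = -1 * v i := fun v => by simp
  have hX : ∀ {k n}, k < n → IsBddMeas (W.past n) (W.centred i k) := fun {k n} hk =>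
    (W.isBddMeas_X hφ (by omega) hk).sub (.const _)
  refine ⟨∑ w ∈ V.allFinset, |w i| + |V.mean (fun v => v i) 1|,
    fun n => (hX n.lt_succ_self).1, fun n ω => ?_, fun n f hf => ?_, fun n => ?_⟩
  · refine (abs_sub _ _).trans (add_le_add ?_ ?_)
    · exact Finset.single_le_sum (f := fun w : EuclideanSpace ℝ (Fin d) => |w i|)
        (fun w _ => abs_nonneg _)
        ((V.mem_allFinset _).2 (V.at_mem_all (W.X_mem (k := n + 1) (by omega) ω)))
    · rw [V.mean_succ_of_odd hs, abs_mul]; simp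
  · rcases Nat.eq_zero_or_pos n with rfl | hn
    -- At time `0` the past is trivial, so `f` is constant; the drift is `0` through division by
    -- zero, in agreement with the centring of the first step.
    · have hbot : ((W.past 0 : MeasurableSpace Ω)) = ⊥ := by simp [past]
      have hf0 := hf.1.stronglyMeasurable
      rw [hbot] at hf0
      obtain ⟨c, rfl⟩ := stronglyMeasurable_bot_iff.1 hf0
      simp [drift, integral_const_mul, integral_centred]
    · have h1 := W.integral_mul_centred_succ hφ hs hn hf
      simp only [centred] at *
      rw [h1]
      have h2 : ∀ ω, f ω * drift (V.delta p q) (V.gamma p q)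
          (fun k => W.X (k + 1) ω i - V.mean (fun v => v i) (k + 1)) n =
          (∑ k ∈ Finset.range n, (V.delta p q + V.gamma p q * (-1) ^ (n + k)) *
            (f ω * (W.X (k + 1) ω i - V.mean (fun v => v i) (k + 1)))) / n := by
        intro ω
        rw [drift, partialSum, altSum, ← mul_div_assoc, Finset.mul_sum, Finset.mul_sum,
          ← Finset.sum_sub_distrib, Finset.mul_sum]
        congr 1
        refine Finset.sum_congr rfl fun k _ => ?_
        rw [pow_add, pow_succ]; ring
      simp only [h2]
      have hint : ∀ k ∈ Finset.range n, Integrable (fun ω =>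
          (V.delta p q + V.gamma p q * (-1) ^ (n + k)) *
            (f ω * (W.X (k + 1) ω i - V.mean (fun v => v i) (k + 1)))) P := fun k hk =>
        ((hf.mul (hX (Finset.mem_range.1 hk))).const_mul _).integrable (W.past.le n)
      rw [integral_div, integral_finsetSum _ hint]
      congr 1
      rw [Finset.range_eq_Ico, ← Finset.Ico_succ_right_eq_Icc, Order.succ_eq_add_one,
        ← Finset.sum_Ico_add' _ 0 n 1]
      refine Finset.sum_congr rfl fun k _ => ?_
      rw [integral_const_mul]
      congr 1
      have he : Even (n + 1 + (k + 1)) ↔ Even (n + k) := by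
        rw [show n + 1 + (k + 1) = n + k + 1 + 1 by ring, Nat.even_add_one, Nat.even_add_one,
          not_not]
      by_cases h : Even (n + k)
      · rw [if_pos (he.2 h), h.neg_one_pow, StepSets.delta, StepSets.gamma]; ring
      · rw [if_neg (mt he.1 h), (Nat.not_even_iff_odd.1 h).neg_one_pow, StepSets.delta,
          StepSets.gamma]; ring
  · have hb := W.isBddMeas_X hφ (k := n + 1) (by omega) le_rfl
    have hI : ∀ {f : Ω → ℝ}, IsBddMeas (W.past (n + 1)) f → Integrable f P :=
      fun hf => hf.integrable (W.past.le _)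
    have hs2 : ∀ v : EuclideanSpace ℝ (Fin d), ((-v) i) ^ 2 = 1 * v i ^ 2 := fun v => by simp
    have h1 := W.integral_X hφ hs (k := n + 1) (by omega)
    have h2 := W.integral_X (hφ.pow_const 2) hs2 (k := n + 1) (by omega)
    have hexp : ∀ ω, W.centred i n ω ^ 2 = W.X (n + 1) ω i ^ 2
        - 2 * V.mean (fun v => v i) (n + 1) * W.X (n + 1) ω i
        + V.mean (fun v => v i) (n + 1) ^ 2 := fun ω => by rw [centred]; ring
    simp only [hexp]
    rw [integral_add (hI ((hb.pow 2).sub (hb.const_mul _))) (integrable_const _),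
      integral_sub (hI (hb.pow 2)) (hI (hb.const_mul _)), integral_const_mul, h1, h2,
      V.mean_succ_of_even hs2, V.mean_succ_of_odd (φ := fun v => v i) hs, StepSets.variance]
    simp only [integral_const, probReal_univ, one_smul]
    have he2 : ((-1 : ℝ) ^ n) ^ 2 = 1 := by rw [← pow_mul, mul_comm, pow_mul]; simp
    linear_combination (-(V.mean (fun v => v i) 1) ^ 2) * he2

/-! ### The position -/

theorem S_apply (n : ℕ) (ω : Ω) (i : Fin d) : W.S n ω i =
    partialSum (fun k => W.centred i k ω) n
      + ∑ k ∈ Finset.range n, V.mean (fun v => v i) (k + 1) := by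
  induction n with
  | zero => simp [Walk.S, partialSum]
  | succ n ih =>
    rw [partialSum_succ, Finset.sum_range_succ, Walk.S, PiLp.add_apply, ih, centred]; ring

/-- The means alternate in sign and cancel in pairs, so the expectation of the position stays
bounded and is negligible against `n^δ`. -/
theorem abs_sum_mean_le (V : StepSets d) (n : ℕ) (i : Fin d) :
    |∑ k ∈ Finset.range n, V.mean (fun v => v i) (k + 1)| ≤ |V.mean (fun v => v i) 1| := by
  have h : ∑ k ∈ Finset.range n, V.mean (fun v => v i) (k + 1) =
      if Even n then 0 else V.mean (fun v => v i) 1 := by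
    induction n with
    | zero => simp
    | succ n ih =>
      rw [Finset.sum_range_succ, ih,
        V.mean_succ_of_odd (φ := fun v => v i) (fun v => by simp) n]
      by_cases hn : Even n
      · simp [hn, Nat.even_add_one]
      · simp [hn, Nat.even_add_one, (Nat.not_even_iff_odd.1 hn).neg_one_pow]
  rw [h]
  split_ifs <;> simp

theorem memLp_S [IsProbabilityMeasure P] (n : ℕ) : MemLp (W.S n) 2 P := by
  induction n with
  | zero => exact MemLp.zero'
  | succ n ih =>
    refine ih.add (MemLp.of_bound (W.measurable_X (by omega)).aestronglyMeasurable
      (∑ w ∈ V.at_ (n + 1), ‖w‖) (ae_of_all _ fun ω => ?_))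
    exact Finset.single_le_sum (f := fun w => ‖w‖) (fun w _ => norm_nonneg _)
      (W.X_mem (by omega) ω)

theorem integral_partialSum [IsProbabilityMeasure P] (i : Fin d) (n : ℕ) :
    ∫ ω, partialSum (fun k => W.centred i k ω) n ∂P = 0 := by
  obtain ⟨K, h⟩ := W.isDriftSequence i
  simp only [partialSum]
  rw [integral_finsetSum _ fun k hk =>
    (h.isBddMeas_step (Finset.mem_range.1 hk)).integrable (W.past.le n)]
  exact Finset.sum_eq_zero fun k _ => W.integral_centred i k

theorem integral_apply {f : Ω → EuclideanSpace ℝ (Fin d)} (hf : Integrable f P) (i : Fin d) :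
    (∫ ω, f ω ∂P) i = ∫ ω, f ω i ∂P :=
  ((EuclideanSpace.proj (𝕜 := ℝ) i).integral_comp_comm hf).symm

theorem S_sub_integral_apply [IsProbabilityMeasure P] (n : ℕ) (ω : Ω) (i : Fin d) :
    (W.S n ω - ∫ ω', W.S n ω' ∂P) i = partialSum (fun k => W.centred i k ω) n := by
  obtain ⟨K, h⟩ := W.isDriftSequence i
  rw [PiLp.sub_apply, integral_apply ((W.memLp_S n).integrable (by norm_num))]
  simp only [S_apply]
  rw [integral_add ((h.isBddMeas_partialSum n).integrable (W.past.le n)) (integrable_const _),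
    W.integral_partialSum]
  simp

theorem integral_norm_sq {f : Ω → EuclideanSpace ℝ (Fin d)}
    (hf : ∀ i, Integrable (fun ω => f ω i ^ 2) P) :
    ∫ ω, ‖f ω‖ ^ 2 ∂P = ∑ i, ∫ ω, f ω i ^ 2 ∂P := by
  simp only [EuclideanSpace.real_norm_sq_eq]
  exact integral_finsetSum _ fun i _ => hf i

theorem integral_norm_sq_S [IsProbabilityMeasure P] (n : ℕ) :
    ∫ ω, ‖W.S n ω - ∫ ω', W.S n ω' ∂P‖ ^ 2 ∂P =
      ∑ i, ∫ ω, partialSum (fun k => W.centred i k ω) n ^ 2 ∂P := by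
  have h : ∀ i, Integrable (fun ω => partialSum (fun k => W.centred i k ω) n ^ 2) P := fun i => by
    obtain ⟨K, h⟩ := W.isDriftSequence i
    exact ((h.isBddMeas_partialSum n).pow 2).integrable (W.past.le n)
  rw [integral_norm_sq]
  · simp only [S_sub_integral_apply]
  · simpa only [S_sub_integral_apply] using h

theorem isMomentRecursion [IsProbabilityMeasure P] :
    IsMomentRecursion (V.delta p q) (V.gamma p q) (∑ i, V.variance fun v => v i)
      (fun n => ∑ i, ∫ ω, partialSum (fun k => W.centred i k ω) n ^ 2 ∂P)
      (fun n => ∑ i, ∫ ω, altSum (fun k => W.centred i k ω) n ^ 2 ∂P)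
      (fun n => ∑ i, ∫ ω, partialSum (fun k => W.centred i k ω) n *
        altSum (fun k => W.centred i k ω) n ∂P) :=
  IsMomentRecursion.sum _ fun i _ => (W.isDriftSequence i).choose_spec.isMomentRecursion

theorem integral_norm_sq_S_eq [IsProbabilityMeasure P] {Ω' : Type*} [MeasurableSpace Ω']
    {P' : Measure Ω'} [IsProbabilityMeasure P'] (W' : Walk V p q P') (n : ℕ) :
    ∫ ω, ‖W.S n ω - ∫ ω', W.S n ω' ∂P‖ ^ 2 ∂P = ∫ ω, ‖W'.S n ω - ∫ ω', W'.S n ω' ∂P'‖ ^ 2 ∂P' := by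
  rw [integral_norm_sq_S, integral_norm_sq_S]
  exact (W.isMomentRecursion.unique W'.isMomentRecursion n).1

theorem limit_pos [IsProbabilityMeasure P] (hγ : |V.gamma p q| ≤ 1 / 2) (hδ : 1 / 2 < V.delta p q)
    (hδ1 : V.delta p q < 1) {C : ℝ} (hC : Tendsto (fun n : ℕ =>
      (∫ ω, ‖W.S n ω - ∫ ω', W.S n ω' ∂P‖ ^ 2 ∂P) / (n : ℝ) ^ (2 * V.delta p q)) atTop (𝓝 C)) :
    0 < C := by
  choose K hK using fun i => W.isDriftSequence i
  simp only [integral_norm_sq_S] at hC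
  refine W.isMomentRecursion.limit_pos hδ hδ1 (fun n u v => ?_) hγ V.sum_variance_pos
    (K := ∑ i, K i ^ 2) (fun n => ?_) hC
  · rw [Finset.mul_sum, Finset.mul_sum, Finset.mul_sum, ← Finset.sum_add_distrib,
      ← Finset.sum_add_distrib]
    exact Finset.sum_nonneg fun i _ => (hK i).moment_form_nonneg n u v
  · rw [Finset.sum_mul]
    exact Finset.sum_le_sum fun i _ => (hK i).integral_altSum_sq_le n

theorem norm_le_sum_norm (v : EuclideanSpace ℝ (Fin d)) : ‖v‖ ≤ ∑ i, ‖v i‖ := by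
  rw [EuclideanSpace.norm_eq]
  exact Real.sqrt_le_iff.2 ⟨Finset.sum_nonneg fun i _ => norm_nonneg _,
    Finset.sum_sq_le_sq_sum_of_nonneg fun i _ => norm_nonneg _⟩

theorem eLpNorm_le_sum_apply {f : Ω → EuclideanSpace ℝ (Fin d)} (hf : Measurable f) :
    eLpNorm f 2 P ≤ ∑ i, eLpNorm (fun ω => f ω i) 2 P := by
  have hm : ∀ i, Measurable fun ω => f ω i := fun i => by fun_prop
  calc eLpNorm f 2 P ≤ eLpNorm (∑ i, fun ω => ‖f ω i‖) 2 P := by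
        refine eLpNorm_mono fun ω => ?_
        rw [Finset.sum_apply]
        exact (norm_le_sum_norm (f ω)).trans (le_abs_self _)
    _ ≤ ∑ i, eLpNorm (fun ω => ‖f ω i‖) 2 P :=
        eLpNorm_sum_le (fun i _ => (hm i).norm.aestronglyMeasurable) (by norm_num)
    _ = _ := by simp only [eLpNorm_norm]

theorem eLpNorm_add_const_le [IsProbabilityMeasure P] {f : Ω → ℝ} (hf : AEStronglyMeasurable f P)
    (c : ℝ) : eLpNorm (f + fun _ => c) 2 P ≤ eLpNorm f 2 P + ENNReal.ofReal |c| := by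
  refine (eLpNorm_add_le hf aestronglyMeasurable_const (by norm_num)).trans ?_
  rw [eLpNorm_const c (by norm_num) (IsProbabilityMeasure.ne_zero P)]
  simp [Real.enorm_eq_ofReal_abs]

/-- The superdiffusive limit of the elephant random walk. -/
theorem exists_limit [IsProbabilityMeasure P] (hγ : |V.gamma p q| ≤ 1 / 2)
    (hδ : 1 / 2 < V.delta p q) (hδ1 : V.delta p q < 1) :
    ∃ L : Ω → EuclideanSpace ℝ (Fin d), Measurable L ∧ MemLp L 2 P ∧
      (∀ᵐ ω ∂P, Tendsto (fun n : ℕ => ((n : ℝ) ^ V.delta p q)⁻¹ • W.S n ω) atTop (𝓝 (L ω))) ∧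
      Tendsto (fun n : ℕ =>
        eLpNorm (fun ω => ((n : ℝ) ^ V.delta p q)⁻¹ • W.S n ω - L ω) 2 P) atTop (𝓝 0) ∧
      (∫ ω, L ω ∂P) = 0 ∧
      Tendsto (fun n : ℕ =>
        (∫ ω, ‖W.S n ω - ∫ ω', W.S n ω' ∂P‖ ^ 2 ∂P) / (n : ℝ) ^ (2 * V.delta p q)) atTop
        (𝓝 (∫ ω, ‖L ω‖ ^ 2 ∂P)) := by
  obtain ⟨δ, hδe⟩ : ∃ δ, δ = V.delta p q := ⟨_, rfl⟩
  choose K hK using fun i => W.isDriftSequence i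
  rw [← hδe] at hδ hδ1 hK ⊢
  choose l hlm hl2 hlae hlL using fun i => (hK i).exists_limit hδ hδ1.le hγ
  have hA : ∀ i (n : ℕ), MemLp (fun ω => partialSum (fun k => W.centred i k ω) n / (n : ℝ) ^ δ) 2 P :=
    fun i n => (((hK i).isBddMeas_partialSum n).div_const _).memLp (W.past.le n) 2
  have hnδ : Tendsto (fun n : ℕ => (n : ℝ) ^ (-δ)) atTop (𝓝 0) :=
    (tendsto_rpow_neg_atTop (by linarith)).comp tendsto_natCast_atTop_atTop
  have hmean : ∀ i, Tendsto (fun n : ℕ =>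
      |∑ k ∈ Finset.range n, V.mean (fun v => v i) (k + 1)| / (n : ℝ) ^ δ) atTop (𝓝 0) := by
    intro i
    have h0 : Tendsto (fun n : ℕ => |V.mean (fun v => v i) 1| * (n : ℝ) ^ (-δ)) atTop (𝓝 0) := by
      simpa using hnδ.const_mul _
    refine squeeze_zero (fun n => by positivity) (fun n => ?_) h0
    rw [Real.rpow_neg (Nat.cast_nonneg n), ← div_eq_mul_inv]
    exact div_le_div_of_nonneg_right (abs_sum_mean_le V n i) (by positivity)
  have hcoord : ∀ i (n : ℕ) ω, (((n : ℝ) ^ δ)⁻¹ • W.S n ω) i =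
      partialSum (fun k => W.centred i k ω) n / (n : ℝ) ^ δ +
        (∑ k ∈ Finset.range n, V.mean (fun v => v i) (k + 1)) / (n : ℝ) ^ δ := by
    intro i n ω
    rw [PiLp.smul_apply, S_apply, smul_eq_mul]; ring
  have hSm : ∀ n, Measurable (W.S n) := by
    intro n
    induction n with
    | zero => exact measurable_const
    | succ n ih => exact ih.add (W.measurable_X (by omega))
  set L : Ω → EuclideanSpace ℝ (Fin d) := fun ω => WithLp.toLp 2 fun i => l i ω with hL
  have hLm : Measurable L := (WithLp.measurable_toLp 2 _).comp (measurable_pi_iff.2 hlm)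
  have hL2 : MemLp L 2 P := by
    refine ⟨hLm.aestronglyMeasurable, (eLpNorm_le_sum_apply hLm).trans_lt ?_⟩
    exact ENNReal.sum_lt_top.2 fun i _ => (hl2 i).2
  refine ⟨L, hLm, hL2, ?_, ?_, ?_, ?_⟩
  · filter_upwards [ae_all_iff.2 hlae] with ω hω
    have h1 : Tendsto (fun (n : ℕ) i => (((n : ℝ) ^ δ)⁻¹ • W.S n ω) i) atTop
        (𝓝 fun i => l i ω) := by
      refine tendsto_pi_nhds.2 fun i => ?_
      simp only [hcoord]
      have h2 := (tendsto_zero_iff_abs_tendsto_zero (fun n : ℕ =>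
        (∑ k ∈ Finset.range n, V.mean (fun v => v i) (k + 1)) / (n : ℝ) ^ δ)).2 (by
          refine (hmean i).congr fun n => ?_
          rw [Function.comp_apply, abs_div, abs_of_nonneg (by positivity : 0 ≤ (n : ℝ) ^ δ)])
      simpa using (hω i).add h2
    exact ((PiLp.continuous_toLp 2 _).tendsto _).comp h1
  · have hb : Tendsto (fun n : ℕ => ∑ i, (eLpNorm
        ((fun ω => partialSum (fun k => W.centred i k ω) n / (n : ℝ) ^ δ) - l i) 2 P +
        ENNReal.ofReal (|∑ k ∈ Finset.range n, V.mean (fun v => v i) (k + 1)| / (n : ℝ) ^ δ)))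
        atTop (𝓝 0) := by
      have h0 : (0 : ENNReal) = ∑ _i : Fin d, (0 + ENNReal.ofReal 0) := by simp
      rw [h0]
      exact tendsto_finsetSum _ fun i _ => (hlL i).add (ENNReal.tendsto_ofReal (hmean i))
    refine tendsto_of_tendsto_of_tendsto_of_le_of_le tendsto_const_nhds hb (fun _ => bot_le)
      fun n => ?_
    refine (eLpNorm_le_sum_apply (((hSm n).const_smul ((n : ℝ) ^ δ)⁻¹).sub hLm)).trans
      (Finset.sum_le_sum fun i _ => ?_)
    have he : (fun ω => ((((n : ℝ) ^ δ)⁻¹ • W.S n - L) ω) i) =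
        ((fun ω => partialSum (fun k => W.centred i k ω) n / (n : ℝ) ^ δ) - l i) +
        fun _ => (∑ k ∈ Finset.range n, V.mean (fun v => v i) (k + 1)) / (n : ℝ) ^ δ := by
      ext ω
      rw [Pi.sub_apply, Pi.smul_apply, PiLp.sub_apply, hcoord]
      simp only [hL, Pi.add_apply, Pi.sub_apply]
      ring
    rw [he]
    have hadd := eLpNorm_add_const_le ((hA i n).sub (hl2 i)).aestronglyMeasurable
      ((∑ k ∈ Finset.range n, V.mean (fun v => v i) (k + 1)) / (n : ℝ) ^ δ)
    rwa [abs_div, abs_of_nonneg (by positivity : 0 ≤ (n : ℝ) ^ δ)] at hadd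
  · refine PiLp.ext fun i => ?_
    rw [integral_apply (hL2.integrable (by norm_num))]
    have h1 := tendsto_integral_of_tendsto_eLpNorm_two (hA i) (hl2 i) (hlL i)
    simp only [integral_div, W.integral_partialSum, zero_div] at h1
    exact (tendsto_nhds_unique h1 tendsto_const_nhds)
  · rw [integral_norm_sq fun i => (hl2 i).integrable_sq]
    simp only [integral_norm_sq_S, Finset.sum_div]
    refine tendsto_finsetSum _ fun i _ => ?_
    refine (tendsto_integral_sq_of_tendsto_eLpNorm (hA i) (hl2 i) (hlL i)).congr fun n => ?_
    rw [← integral_div]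
    congr 1; ext ω
    rw [div_pow, mul_comm 2 δ, Real.rpow_mul (Nat.cast_nonneg n), Real.rpow_two]

end Walk

end ERW

theorem mainTheorem3 {d : ℕ} (V : ERW.StepSets d) (p q : ℝ)
    (hp : p ∈ Set.Icc (0 : ℝ) 1) (hq : q ∈ Set.Icc (0 : ℝ) 1)
    (hδ_gt : 1 / 2 < V.delta p q) (hδ_lt : V.delta p q < 1) :
    ∃ C : ℝ, 0 < C ∧
      ∀ (Ω : Type*) [MeasurableSpace Ω] (P : Measure Ω) [IsProbabilityMeasure P]
        (W : ERW.Walk V p q P),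
        (∀ n, MemLp (W.S n) 2 P) ∧
        ((fun n : ℕ => ∫ ω, ‖W.S n ω - ∫ ω', W.S n ω' ∂P‖ ^ 2 ∂P) ~[atTop]
          fun n : ℕ => C * (n : ℝ) ^ (2 * V.delta p q)) ∧
        ∃ L : Ω → EuclideanSpace ℝ (Fin d), Measurable L ∧ MemLp L 2 P ∧
          (∀ᵐ ω ∂P, Tendsto (fun n : ℕ => ((n : ℝ) ^ V.delta p q)⁻¹ • W.S n ω) atTop
            (𝓝 (L ω))) ∧
          Tendsto (fun n : ℕ =>
            eLpNorm (fun ω => ((n : ℝ) ^ V.delta p q)⁻¹ • W.S n ω - L ω) 2 P) atTop (𝓝 0) ∧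
          (∫ ω, L ω ∂P) = 0 ∧
          (∫ ω, ‖L ω‖ ^ 2 ∂P) = C ∧
          ¬ ∃ c : EuclideanSpace ℝ (Fin d), ∀ᵐ ω ∂P, L ω = c := by
  have hγ := V.abs_gamma_le hp.2 hq.1 hδ_gt
  suffices hC : ∃ C : ℝ, 0 < C ∧ ∀ (Ω : Type _) [MeasurableSpace Ω] (P : Measure Ω)
      [IsProbabilityMeasure P] (W : ERW.Walk V p q P), Tendsto (fun n : ℕ =>
        (∫ ω, ‖W.S n ω - ∫ ω', W.S n ω' ∂P‖ ^ 2 ∂P) / (n : ℝ) ^ (2 * V.delta p q)) atTop (𝓝 C) by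
    obtain ⟨C, hC0, hC⟩ := hC
    refine ⟨C, hC0, fun Ω _ P _ W => ⟨W.memLp_S, ?_, ?_⟩⟩
    · have hne : ∀ᶠ n : ℕ in atTop, C * (n : ℝ) ^ (2 * V.delta p q) ≠ 0 := by
        filter_upwards [eventually_ge_atTop 1] with n hn
        have : (0 : ℝ) < n := by exact_mod_cast hn
        positivity
      rw [isEquivalent_iff_tendsto_one hne]
      have h1 := (hC Ω P W).div_const C
      rw [div_self hC0.ne'] at h1
      refine h1.congr fun n => ?_
      rw [Pi.div_apply, div_div, mul_comm C]
    · obtain ⟨L, hLm, hL2, hae, hL, hmean, hlim⟩ := W.exists_limit hγ hδ_gt hδ_lt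
      have hLC := tendsto_nhds_unique hlim (hC Ω P W)
      refine ⟨L, hLm, hL2, hae, hL, hmean, hLC, fun ⟨c, hc⟩ => ?_⟩
      -- An almost surely constant limit would equal its mean `0`, which contradicts `E[|L|²] = C >
      -- 0`.
      have hc0 : c = 0 := by
        rw [← hmean, integral_congr_ae hc]; simp
      have : ∫ ω, ‖L ω‖ ^ 2 ∂P = 0 := by
        rw [integral_congr_ae (hc.mono fun ω hω => show ‖L ω‖ ^ 2 = 0 by rw [hω, hc0]; simp)]
        simp
      linarith
  -- The constant must be chosen before the walk. It is read off from any one walk and transferred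
  -- by `integral_norm_sq_S_eq`; if there were no walk, any positive constant would do, so existence
  -- need not be proved.
  by_cases hW : ∃ (Ω : Type _) (_ : MeasurableSpace Ω) (P : Measure Ω) (_ : IsProbabilityMeasure P),
      Nonempty (ERW.Walk V p q P)
  · obtain ⟨Ω₀, _, P₀, _, ⟨W₀⟩⟩ := hW
    obtain ⟨L, -, -, -, -, -, hlim⟩ := W₀.exists_limit hγ hδ_gt hδ_lt
    refine ⟨_, W₀.limit_pos hγ hδ_gt hδ_lt hlim, fun Ω _ P _ W => ?_⟩
    exact hlim.congr fun n => by rw [W₀.integral_norm_sq_S_eq W]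
  · exact ⟨1, one_pos, fun Ω _ P _ W => (hW ⟨Ω, _, P, ‹_›, ⟨W⟩⟩).elim⟩
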